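/- Notation. Let $d\ge 1$, let $\mathbb D^d=\{z\in\mathbb C^d: |z^i|<1,\ i=1,\dots,d\}$, and let $H^\infty_d$ be the algebra of bounded holomorphic functions on $\mathbb D^d$ with the norm $\|\varphi\|_\infty=\sup_{z\in\mathbb D^d}|\varphi(z)|$. A $d$-tuple $M=(M^1,\dots,M^d)$ of commuting $m\times m$ complex matrices has joint spectrum $\sigma(M)=\{\lambda\in\mathbb C^d:\ \exists x\neq 0,\ M^ix=\lambda^ix \text{ for all } i\}$. If $\sigma(M)\subset\mathbb D^d$ and $f$ is holomorphic on $\mathbb D^d$, then $$f(M)=\frac1{(2\pi i)^d}\int_{|\xi^1|=r}\cdots\int_{|\xi^d|=r} f(\xi)\,(\xi^1 I-M^1)^{-1}\cdots(\xi^d I-M^d)^{-1}\,d\xi^1\cdots d\xi^d,$$ where $r<1$ is larger than $|\lambda^i|$ for every $\lambda\in\sigma(M)$ and every $i$ (the value does not depend on $r$). An admissible kernel on $\mathbb D^d$ is the reproducing kernel $k$ of a Hilbert space $\mathcal H_k$ of holomorphic functions on $\mathbb D^d$, with continuous point evaluations, on which multiplication by each coordinate function $z^1,\dots,z^d$ is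 a contraction. Let $\mathcal A_d$ be the set of all admissible kernels on $\mathbb D^d$. For $k\in\mathcal A_d$ and $z\in\mathbb D^d$ let $k_z\in\mathcal H_k$ be the vector with $\langle f,k_z\rangle=f(z)$ for all $f\in\mathcal H_k$; for $M$ as above and $u,v\in\mathbb C^m$ let $K_M(u,v)\in\mathcal H_k$ be the vector with $\langle f,K_M(u,v)\rangle=\langle f(M)u,v\rangle_{\mathbb C^m}$ for all $f\in\mathcal H_k$. Let $A_1,\dots,A_N$ be $d$-tuples of commuting matrices, of possibly different sizes $s_1,\dots,s_N$, with joint spectra in $\mathbb D^d$, and let $\varphi_1,\dots,\varphi_N\in H^\infty_d$. For $k\in\mathcal A_d$ put $H_0=\operatorname{span}\{K_{A_j}(u,v): 1\le j\le N,\ u,v\in\mathbb C^{s_j}\}\subset\mathcal H_k$, and let $R^k\colon H_0\to H_0$ be the linear map with $$R^k\big(K_{A_j}(u,v)\big)=K_{A_j}\big(u,\varphi_j(A_j)^*v\big),\qquad 1\le j\le N,\ u,v\in\mathbb C^{s_j}.$$ For $z\in\mathbb D^d$ and $w\in\mathbb C$ let $\tilde R^k_w$ be the linear map on $H_1=\operatorname{span}(H_0\cup\{k_z\})$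 that extends $R^k$ and satisfies $\tilde R^k_w(k_z)=\overline w\,k_z$. Here $\|R^k\|$, respectively $\|\tilde R^k_w\|$, denotes the operator norm, understood to be $\infty$ if no linear map with the stated property exists. Theorem. (1) Let $d=2$. If $\sup_{k\in\mathcal A_2}\|R^k\|\le 1$, then there exists $\varphi\in H^\infty_2$ with $\|\varphi\|_\infty\le1$ and $\varphi(A_j)=\varphi_j(A_j)$ for $j=1,\dots,N$. (2) Let $d\ge1$ be arbitrary. For every $z\in\mathbb D^d$ there exists $w\in\mathbb C$, independent of $k$, such that $$\sup_{k\in\mathcal A_d}\|\tilde R^k_w\|=\sup_{k\in\mathcal A_d}\|R^k\|.$$ -/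

import Mathlib

open scoped ENNReal Matrix ComplexConjugate

noncomputable section

/-- The open unit polydisc of dimension `d`. -/
def polydisc (d : ℕ) : Set (Fin d → ℂ) := {z | ∀ i, ‖z i‖ < 1}

/-- The supremum norm of a function over the polydisc, with values in `[0, ∞]`. -/
def supNorm {d : ℕ} (φ : (Fin d → ℂ) → ℂ) : ℝ≥0∞ := ⨆ z ∈ polydisc d, ‖φ z‖ₑ

/-- `φ` restricts to a bounded holomorphic function on the polydisc. (The values of `φ` off the
polydisc are irrelevant.) -/
def MemHInfty {d : ℕ} (φ : (Fin d → ℂ) → ℂ) : Prop :=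
  DifferentiableOn ℂ φ (polydisc d) ∧ supNorm φ < ∞

/-- The joint spectrum of a `d`-tuple of `m × m` matrices: the set of its joint eigenvalues. -/
def jointSpectrum {d m : ℕ} (M : Fin d → Matrix (Fin m) (Fin m) ℂ) : Set (Fin d → ℂ) :=
  {lam | ∃ x : Fin m → ℂ, x ≠ 0 ∧ ∀ i, M i *ᵥ x = lam i • x}

/-- A `d`-tuple of commuting matrices with joint spectrum in the polydisc. -/
structure IsNode {d m : ℕ} (M : Fin d → Matrix (Fin m) (Fin m) ℂ) : Prop where
  commute : ∀ i j, Commute (M i) (M j)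
  spectrum_subset : jointSpectrum M ⊆ polydisc d

/-- A radius in `(0, 1)` that is larger than the modulus of each coordinate of each joint
eigenvalue of `M` (for `M` with joint spectrum in the polydisc). -/
def evalRadius {d m : ℕ} (M : Fin d → Matrix (Fin m) (Fin m) ℂ) : ℝ :=
  (1 + sSup (norm '' jointSpectrum M)) / 2

/-- The product `(ξ¹ - M¹)⁻¹ ⋯ (ξᵈ - Mᵈ)⁻¹` of the resolvents. -/
def resolventProd {d m : ℕ} (M : Fin d → Matrix (Fin m) (Fin m) ℂ) (ξ : Fin d → ℂ) :
    Matrix (Fin m) (Fin m) ℂ :=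
  (List.ofFn fun i => (ξ i • (1 : Matrix (Fin m) (Fin m) ℂ) - M i)⁻¹).prod

/-- The value `f(M)` of a holomorphic function on the polydisc at a `d`-tuple of commuting
matrices with joint spectrum in the polydisc, by the Cauchy integral formula
`(2πi)⁻ᵈ ∫ f(ξ) (ξ¹ - M¹)⁻¹ ⋯ (ξᵈ - Mᵈ)⁻¹ dξ¹ ⋯ dξᵈ`. The integral (taken entrywise) is over a
torus inside the polydisc that surrounds the joint spectrum, so that no boundary values of `f` are
needed; by Cauchy's theorem the choice of the torus does not matter. -/
def matEval {d m : ℕ} (f : (Fin d → ℂ) → ℂ) (M : Fin d → Matrix (Fin m) (Fin m) ℂ) :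
    Matrix (Fin m) (Fin m) ℂ :=
  Matrix.of fun a b =>
    ((2 * (Real.pi : ℂ) * Complex.I) ^ d)⁻¹ *
      torusIntegral (fun ξ => f ξ * resolventProd M ξ a b) 0 (fun _ => evalRadius M)

/-- Extension by zero of a function on the polydisc. -/
def extendZero {d : ℕ} (f : polydisc d → ℂ) : (Fin d → ℂ) → ℂ :=
  Function.extend Subtype.val f 0

/-- An admissible kernel on the polydisc, given by its reproducing kernel Hilbert space `H`: a
Hilbert space of holomorphic functions on the polydisc with continuous point evaluations, on which
the multiplication by each coordinate function is a contraction. -/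
structure AdmissibleKernel (d : ℕ) where
  /-- The Hilbert space of functions. -/
  H : Type
  [normedAddCommGroup : NormedAddCommGroup H]
  [innerProductSpace : InnerProductSpace ℂ H]
  [completeSpace : CompleteSpace H]
  [rkhs : RKHS ℂ H (polydisc d) ℂ]
  holomorphic : ∀ f : H, DifferentiableOn ℂ (extendZero f) (polydisc d)
  contraction : ∀ (i : Fin d) (f : H), ∃ g : H, (∀ z : polydisc d, g z = z.1 i * f z) ∧ ‖g‖ ≤ ‖f‖

attribute [instance] AdmissibleKernel.normedAddCommGroup AdmissibleKernel.innerProductSpace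
  AdmissibleKernel.completeSpace AdmissibleKernel.rkhs

/-! ### Existence of the vectors that represent `f ↦ ⟨f(M) u, v⟩` -/

theorem extendZero_apply {d : ℕ} (f : polydisc d → ℂ) (z : polydisc d) :
    extendZero f z.1 = f z :=
  Subtype.val_injective.extend_apply f 0 z

theorem exists_joint_eigenvector {d m : ℕ} {M : Fin d → Matrix (Fin m) (Fin m) ℂ}
    (hM : ∀ i j, Commute (M i) (M j)) (W : Submodule ℂ (Fin m → ℂ)) (hW : W ≠ ⊥)
    (hinv : ∀ i, ∀ x ∈ W, M i *ᵥ x ∈ W) (S : Finset (Fin d)) :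
    ∃ W' : Submodule ℂ (Fin m → ℂ), W' ≤ W ∧ W' ≠ ⊥ ∧ (∀ i, ∀ x ∈ W', M i *ᵥ x ∈ W') ∧
      ∀ i ∈ S, ∃ c : ℂ, ∀ x ∈ W', M i *ᵥ x = c • x := by
  classical
  induction S using Finset.induction_on with
  | empty => exact ⟨W, le_rfl, hW, hinv, by simp⟩
  | insert j S hj ih =>
    obtain ⟨W', hle, hne, hinv', hS⟩ := ih
    let T : Module.End ℂ (Fin m → ℂ) := Matrix.toLin' (M j)
    have hT : ∀ x ∈ W', T x ∈ W' := fun x hx => by simpa [T] using hinv' j x hx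
    have : Nontrivial W' := Submodule.nontrivial_iff_ne_bot.mpr hne
    obtain ⟨c, hc⟩ := Module.End.exists_eigenvalue (T.restrict hT)
    obtain ⟨x, hx⟩ := hc.exists_hasEigenvector
    have hx1 : T x.1 = c • x.1 := by
      have := congrArg Subtype.val hx.apply_eq_smul
      simpa using this
    refine ⟨W' ⊓ Module.End.eigenspace T c, inf_le_left.trans hle, ?_, ?_, ?_⟩
    · intro h
      have : x.1 ∈ W' ⊓ Module.End.eigenspace T c :=
        ⟨x.2, Module.End.mem_eigenspace_iff.mpr hx1⟩
      rw [h, Submodule.mem_bot] at this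
      exact hx.2 (Subtype.ext this)
    · rintro i y ⟨hy, hy2⟩
      refine ⟨hinv' i y hy, ?_⟩
      have hy2 := Module.End.mem_eigenspace_iff.mp hy2
      refine Module.End.mem_eigenspace_iff.mpr ?_
      simp only [T, Matrix.toLin'_apply] at hy2 ⊢
      rw [Matrix.mulVec_mulVec, (hM j i).eq, ← Matrix.mulVec_mulVec, hy2, Matrix.mulVec_smul]
    · intro i hi
      rcases Finset.mem_insert.mp hi with rfl | hi
      · exact ⟨c, fun y hy => by
          simpa [T] using Module.End.mem_eigenspace_iff.mp hy.2⟩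
      · obtain ⟨c', hc'⟩ := hS i hi
        exact ⟨c', fun y hy => hc' y hy.1⟩

theorem exists_mem_jointSpectrum {d m : ℕ} {M : Fin d → Matrix (Fin m) (Fin m) ℂ}
    (hM : ∀ i j, Commute (M i) (M j)) (i : Fin d) (c : ℂ)
    (hc : (c • (1 : Matrix (Fin m) (Fin m) ℂ) - M i).det = 0) :
    ∃ lam ∈ jointSpectrum M, lam i = c := by
  classical
  obtain ⟨x, hx0, hx⟩ := Matrix.exists_mulVec_eq_zero_iff.mpr hc
  rw [Matrix.sub_mulVec, Matrix.smul_mulVec, Matrix.one_mulVec, sub_eq_zero] at hx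
  let W : Submodule ℂ (Fin m → ℂ) := Module.End.eigenspace (Matrix.toLin' (M i)) c
  have hmem : ∀ y, y ∈ W ↔ M i *ᵥ y = c • y := fun y => by
    simp only [W, Module.End.mem_eigenspace_iff, Matrix.toLin'_apply]
  have hW : W ≠ ⊥ := fun h => by
    have : x ∈ W := (hmem x).mpr hx.symm
    rw [h, Submodule.mem_bot] at this
    exact hx0 this
  obtain ⟨W', hle, hne, -, hS⟩ := exists_joint_eigenvector hM W hW (fun j y hy => by
    rw [hmem] at hy ⊢
    rw [Matrix.mulVec_mulVec, (hM i j).eq, ← Matrix.mulVec_mulVec, hy, Matrix.mulVec_smul])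
    Finset.univ
  obtain ⟨y, hy, hy0⟩ := W'.ne_bot_iff.mp hne
  choose lam hlam using fun j => hS j (Finset.mem_univ j)
  refine ⟨lam, ⟨y, hy0, fun j => hlam j y hy⟩, ?_⟩
  have h1 := hlam i y hy
  rw [(hmem y).mp (hle hy)] at h1
  exact (smul_left_injective ℂ hy0 h1).symm

theorem finite_jointSpectrum {d m : ℕ} (M : Fin d → Matrix (Fin m) (Fin m) ℂ) :
    (jointSpectrum M).Finite := by
  classical
  refine (Set.Finite.pi' (fun i : Fin d =>
    Module.End.finite_hasEigenvalue (Matrix.toLin' (M i)))).subset ?_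
  rintro lam ⟨x, hx0, hx⟩ i
  refine Module.End.hasEigenvalue_of_hasEigenvector (x := x) ⟨?_, hx0⟩
  exact Module.End.mem_eigenspace_iff.mpr (by simpa using hx i)

theorem norm_lt_one_of_mem_polydisc {d : ℕ} {z : Fin d → ℂ} (hz : z ∈ polydisc d) : ‖z‖ < 1 :=
  (pi_norm_lt_iff one_pos).mpr hz

theorem IsNode.sSup_lt_one {d m : ℕ} {M : Fin d → Matrix (Fin m) (Fin m) ℂ} (hM : IsNode M) :
    0 ≤ sSup (norm '' jointSpectrum M) ∧ sSup (norm '' jointSpectrum M) < 1 := by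
  refine ⟨Real.sSup_nonneg (by rintro _ ⟨z, -, rfl⟩; exact norm_nonneg z), ?_⟩
  rcases (norm '' jointSpectrum M).eq_empty_or_nonempty with h | h
  · rw [h, Real.sSup_empty]; exact one_pos
  · obtain ⟨z, hz, h1⟩ := h.csSup_mem ((finite_jointSpectrum M).image norm)
    rw [← h1]
    exact norm_lt_one_of_mem_polydisc (hM.spectrum_subset hz)

theorem IsNode.det_ne_zero {d m : ℕ} {M : Fin d → Matrix (Fin m) (Fin m) ℂ} (hM : IsNode M)
    (i : Fin d) {c : ℂ} (hc : ‖c‖ = evalRadius M) :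
    (c • (1 : Matrix (Fin m) (Fin m) ℂ) - M i).det ≠ 0 := by
  intro h
  obtain ⟨lam, hlam, rfl⟩ := exists_mem_jointSpectrum hM.commute i c h
  have h1 : ‖lam‖ ≤ sSup (norm '' jointSpectrum M) :=
    le_csSup ((finite_jointSpectrum M).image norm).bddAbove ⟨lam, hlam, rfl⟩
  have h2 := norm_le_pi_norm lam i
  have h3 := hM.sSup_lt_one
  rw [hc, evalRadius] at h2
  linarith

theorem IsNode.norm_torusMap {d m : ℕ} {M : Fin d → Matrix (Fin m) (Fin m) ℂ} (hM : IsNode M)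
    (θ : Fin d → ℝ) (i : Fin d) :
    ‖torusMap 0 (fun _ => evalRadius M) θ i‖ = evalRadius M := by
  have h : 0 ≤ evalRadius M := by have := hM.sSup_lt_one; unfold evalRadius; linarith
  simp [torusMap, Complex.norm_exp_ofReal_mul_I, abs_of_nonneg h]

theorem continuous_torusMap_zero {d : ℕ} (R : Fin d → ℝ) : Continuous (torusMap 0 R) := by
  unfold torusMap; fun_prop

theorem isCompact_torus {d : ℕ} (r : ℝ) : IsCompact {z : Fin d → ℂ | ∀ i, ‖z i‖ = r} := by
  have h : {z : Fin d → ℂ | ∀ i, ‖z i‖ = r} = Set.univ.pi fun _ => Metric.sphere (0 : ℂ) r := by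
    ext z; simp
  rw [h]
  exact isCompact_univ_pi fun _ => isCompact_sphere _ _

theorem IsNode.continuousOn_resolventProd {d m : ℕ} {M : Fin d → Matrix (Fin m) (Fin m) ℂ}
    (hM : IsNode M) :
    ContinuousOn (resolventProd M) {z : Fin d → ℂ | ∀ i, ‖z i‖ = evalRadius M} := by
  rw [continuousOn_iff_continuous_domRestrict]
  have h : ∀ i : Fin d, Continuous fun z : {z : Fin d → ℂ | ∀ i, ‖z i‖ = evalRadius M} =>
      (z.1 i • (1 : Matrix (Fin m) (Fin m) ℂ) - M i)⁻¹ := by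
    intro i
    have hc : Continuous fun z : {z : Fin d → ℂ | ∀ i, ‖z i‖ = evalRadius M} =>
        z.1 i • (1 : Matrix (Fin m) (Fin m) ℂ) - M i :=
      (((continuous_apply i).comp continuous_subtype_val).smul continuous_const).sub
        continuous_const
    simp only [Matrix.inv_def, Ring.inverse_eq_inv']
    exact (hc.matrix_det.inv₀ fun z => hM.det_ne_zero i (z.2 i)).smul hc.matrix_adjugate
  change Continuous fun z : {z : Fin d → ℂ | ∀ i, ‖z i‖ = evalRadius M} => resolventProd M z.1
  simp only [resolventProd, List.ofFn_eq_map]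
  exact continuous_list_prod _ fun i _ => h i

theorem AdmissibleKernel.exists_torus_functional {d m : ℕ} (k : AdmissibleKernel d)
    {M : Fin d → Matrix (Fin m) (Fin m) ℂ} (hM : IsNode M) (a b : Fin m) :
    ∃ L : k.H →L[ℂ] ℂ, ∀ f : k.H, L f =
      torusIntegral (fun ξ => extendZero f ξ * resolventProd M ξ a b) 0
        (fun _ => evalRadius M) := by
  set T : Set (Fin d → ℂ) := {z | ∀ i, ‖z i‖ = evalRadius M} with hT
  have hTm : ∀ θ, torusMap 0 (fun _ => evalRadius M) θ ∈ T := hM.norm_torusMap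
  have hTp : ∀ z ∈ T, z ∈ polydisc d := fun z hz i => by
    rw [hz i]
    have := hM.sSup_lt_one; unfold evalRadius; linarith
  have hTc : IsCompact T := isCompact_torus _
  have hr : ContinuousOn (fun ξ => resolventProd M ξ a b) T :=
    (continuous_apply_apply a b).comp_continuousOn hM.continuousOn_resolventProd
  have hf : ∀ f : k.H, ContinuousOn (extendZero f) T := fun f =>
    (k.holomorphic f).continuousOn.mono hTp
  have hint : ∀ f : k.H, TorusIntegrable (fun ξ => extendZero f ξ * resolventProd M ξ a b) 0
      (fun _ => evalRadius M) := fun f =>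
    (((hf f).mul hr).comp_continuous (continuous_torusMap_zero _) hTm).integrableOn_Icc
  -- uniform boundedness of the point evaluations on the torus
  let ev : T → k.H →L[ℂ] ℂ := fun z =>
    (ContinuousLinearMap.proj (R := ℂ) (φ := fun _ : polydisc d => ℂ) ⟨z.1, hTp z z.2⟩).comp
      (RKHS.coeCLM ℂ)
  have hev : ∀ (z : T) (f : k.H), ev z f = extendZero f z.1 := fun z f =>
    (extendZero_apply f ⟨z.1, hTp z z.2⟩).symm
  obtain ⟨B, hB⟩ : ∃ B, ∀ z, ‖ev z‖ ≤ B := by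
    refine banach_steinhaus fun f => ?_
    obtain ⟨C, hC⟩ := hTc.exists_bound_of_continuousOn (hf f)
    exact ⟨C, fun z => by rw [hev]; exact hC z z.2⟩
  obtain ⟨C, hC⟩ := hTc.exists_bound_of_continuousOn hr
  have hadd : ∀ f g : k.H, extendZero (⇑(f + g)) = extendZero f + extendZero g := fun f g => by
    rw [RKHS.coe_add]
    ext z
    by_cases hz : z ∈ polydisc d
    · lift z to polydisc d using hz
      simp [extendZero_apply]
    · have : ¬∃ y : polydisc d, y.1 = z := by rintro ⟨y, rfl⟩; exact hz y.2
      simp [extendZero, Function.extend_apply' _ _ _ this]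
  have hsmul : ∀ (c : ℂ) (f : k.H), extendZero (⇑(c • f)) = c • extendZero f := fun c f => by
    rw [RKHS.coe_smul]
    ext z
    by_cases hz : z ∈ polydisc d
    · lift z to polydisc d using hz
      simp [extendZero_apply]
    · have : ¬∃ y : polydisc d, y.1 = z := by rintro ⟨y, rfl⟩; exact hz y.2
      simp [extendZero, Function.extend_apply' _ _ _ this]
  let L₀ : k.H →ₗ[ℂ] ℂ :=
    { toFun := fun f => torusIntegral (fun ξ => extendZero f ξ * resolventProd M ξ a b) 0
        (fun _ => evalRadius M)
      map_add' := fun f g => by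
        rw [← torusIntegral_add (hint f) (hint g)]
        congr 1
        ext ξ
        rw [hadd, Pi.add_apply, add_mul]
      map_smul' := fun c f => by
        rw [RingHom.id_apply, ← torusIntegral_smul]
        congr 1
        ext ξ
        rw [hsmul, Pi.smul_apply, smul_mul_assoc] }
  refine ⟨L₀.mkContinuous ((2 * Real.pi) ^ d * (∏ _i : Fin d, |evalRadius M|) * (B * C))
    fun f => ?_, fun f => rfl⟩
  have hb : ∀ θ, ‖extendZero f (torusMap 0 (fun _ => evalRadius M) θ) *
      resolventProd M (torusMap 0 (fun _ => evalRadius M) θ) a b‖ ≤ B * ‖f‖ * C := fun θ => by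
    rw [norm_mul]
    have h1 : ‖extendZero f (torusMap 0 (fun _ => evalRadius M) θ)‖ ≤ B * ‖f‖ := by
      rw [← hev ⟨_, hTm θ⟩ f]
      exact (ev ⟨_, hTm θ⟩).le_of_opNorm_le (hB _) f
    exact mul_le_mul h1 (hC _ (hTm θ)) (norm_nonneg _) ((norm_nonneg _).trans h1)
  have h2 := norm_torusIntegral_le_of_norm_le_const
    (f := fun ξ => extendZero f ξ * resolventProd M ξ a b) hb
  refine h2.trans (le_of_eq ?_)
  ring

/-- For a node `M` and vectors `u`, `v`, the functional `f ↦ ⟨f(M) u, v⟩` is represented by a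
unique vector. (Mathlib's inner product is conjugate-linear in its first argument.) -/
theorem AdmissibleKernel.existsUnique_nodeKernel {d m : ℕ} (k : AdmissibleKernel d)
    {M : Fin d → Matrix (Fin m) (Fin m) ℂ} (hM : IsNode M) (u v : Fin m → ℂ) :
    ∃! K : k.H, ∀ f : k.H, inner ℂ K f = star v ⬝ᵥ (matEval (extendZero f) M *ᵥ u) := by
  choose L hL using fun a b => k.exists_torus_functional hM a b
  let Φ : k.H →L[ℂ] ℂ :=
    ∑ a, ∑ b, (star v a * (((2 * (Real.pi : ℂ) * Complex.I) ^ d)⁻¹ * u b)) • L a b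
  have hΦ : ∀ f : k.H, Φ f = star v ⬝ᵥ (matEval (extendZero f) M *ᵥ u) := by
    intro f
    simp only [Φ, sum_apply, smul_apply, hL, dotProduct,
      Matrix.mulVec, matEval, Matrix.of_apply, Finset.mul_sum, smul_eq_mul]
    exact Finset.sum_congr rfl fun a _ => Finset.sum_congr rfl fun b _ => by ring
  refine ⟨(InnerProductSpace.toDual ℂ k.H).symm Φ, fun f => ?_, fun K hK => ?_⟩
  · rw [← hΦ, InnerProductSpace.toDual_symm_apply]
  · refine ext_inner_right ℂ fun f => ?_
    rw [hK, ← hΦ, InnerProductSpace.toDual_symm_apply]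

/-- The vector `K_M(u, v)` of the reproducing kernel Hilbert space, determined by
`⟨f, K_M(u, v)⟩ = ⟨f(M) u, v⟩` for all `f`. -/
def AdmissibleKernel.nodeKernel {d m : ℕ} (k : AdmissibleKernel d)
    {M : Fin d → Matrix (Fin m) (Fin m) ℂ} (hM : IsNode M) (u v : Fin m → ℂ) : k.H :=
  (k.existsUnique_nodeKernel hM u v).choose

theorem AdmissibleKernel.inner_nodeKernel {d m : ℕ} (k : AdmissibleKernel d)
    {M : Fin d → Matrix (Fin m) (Fin m) ℂ} (hM : IsNode M) (u v : Fin m → ℂ) (f : k.H) :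
    inner ℂ (k.nodeKernel hM u v) f = star v ⬝ᵥ (matEval (extendZero f) M *ᵥ u) :=
  (k.existsUnique_nodeKernel hM u v).choose_spec.1 f

/-- The reproducing kernel function `k_z` at the point `z`: `⟨f, k_z⟩ = f(z)` for all `f`. -/
def AdmissibleKernel.pointKernel {d : ℕ} (k : AdmissibleKernel d) (z : polydisc d) : k.H :=
  RKHS.kerFun k.H z 1

/-! ### The operators -/

section operators

variable {d N : ℕ} (k : AdmissibleKernel d) {s : Fin N → ℕ}
  {A : ∀ j, Fin d → Matrix (Fin (s j)) (Fin (s j)) ℂ} (hA : ∀ j, IsNode (A j))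
  (φ : Fin N → (Fin d → ℂ) → ℂ) (z : polydisc d) (w : ℂ)

/-- The span `H₀` of all vectors `K_{A_j}(u, v)`. -/
def AdmissibleKernel.nodeSpace : Submodule ℂ k.H :=
  Submodule.span ℂ {x | ∃ j u v, x = k.nodeKernel (hA j) u v}

/-- The span `H₁` of `H₀` and `k_z`. -/
def AdmissibleKernel.nodeSpaceExt : Submodule ℂ k.H :=
  k.nodeSpace hA ⊔ Submodule.span ℂ {k.pointKernel z}

theorem AdmissibleKernel.nodeKernel_mem (j : Fin N) (u v : Fin (s j) → ℂ) :
    k.nodeKernel (hA j) u v ∈ k.nodeSpace hA :=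
  Submodule.subset_span ⟨j, u, v, rfl⟩

theorem AdmissibleKernel.nodeKernel_mem_ext (j : Fin N) (u v : Fin (s j) → ℂ) :
    k.nodeKernel (hA j) u v ∈ k.nodeSpaceExt hA z :=
  Submodule.mem_sup_left (k.nodeKernel_mem hA j u v)

theorem AdmissibleKernel.pointKernel_mem_ext :
    k.pointKernel z ∈ k.nodeSpaceExt hA z :=
  Submodule.mem_sup_right (Submodule.mem_span_singleton_self _)

/-- `R : H₀ → H₀` satisfies `R (K_{A_j}(u, v)) = K_{A_j}(u, φ_j(A_j)^* v)` for all `j, u, v`. There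
is at most one such `R`. -/
def AdmissibleKernel.IsR (R : k.nodeSpace hA →L[ℂ] k.nodeSpace hA) : Prop :=
  ∀ j u v, R ⟨k.nodeKernel (hA j) u v, k.nodeKernel_mem hA j u v⟩ =
    ⟨k.nodeKernel (hA j) u ((matEval (φ j) (A j))ᴴ *ᵥ v), k.nodeKernel_mem hA j u _⟩

/-- `R : H₁ → H₁` satisfies `R (K_{A_j}(u, v)) = K_{A_j}(u, φ_j(A_j)^* v)` for all `j, u, v`, and
`R k_z = w̄ k_z`. There is at most one such `R`. -/
def AdmissibleKernel.IsRExt (R : k.nodeSpaceExt hA z →L[ℂ] k.nodeSpaceExt hA z) : Prop :=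
  (∀ j u v, R ⟨k.nodeKernel (hA j) u v, k.nodeKernel_mem_ext hA z j u v⟩ =
    ⟨k.nodeKernel (hA j) u ((matEval (φ j) (A j))ᴴ *ᵥ v), k.nodeKernel_mem_ext hA z j u _⟩) ∧
  R ⟨k.pointKernel z, k.pointKernel_mem_ext hA z⟩ =
    conj w • ⟨k.pointKernel z, k.pointKernel_mem_ext hA z⟩

/-- The operator norm of the operator `R^k : H₀ → H₀` with
`R^k (K_{A_j}(u, v)) = K_{A_j}(u, φ_j(A_j)^* v)`. It is `∞` if there is no such operator, that is,
if this formula is inconsistent. -/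
def AdmissibleKernel.normR : ℝ≥0∞ := ⨅ (R) (_ : k.IsR hA φ R), ‖R‖ₑ

/-- The operator norm of the operator on `H₁` that extends `R^k` by `k_z ↦ w̄ k_z`. It is `∞` if
there is no such operator. -/
def AdmissibleKernel.normRExt : ℝ≥0∞ := ⨅ (R) (_ : k.IsRExt hA φ z w R), ‖R‖ₑ

end operators

end

noncomputable section

/-! Both parts follow from one statement: if `‖R^k‖ ≤ C` for every admissible kernel, with `C`
finite, then some `F` of Schur–Agler class satisfies `C F(A_j) = φ_j(A_j)` for all `j`
(`exists_interpolating_transferFunction`). Here `F` is the transfer function of a finite contractive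
system; it is bounded by 1 and is a contractive multiplier of every `H_k`.

To find `F`, put all matrices `f(A_j)` into one vector, on which multiplication by `z^i` acts as a
matrix `X_i` (left multiplication by the `A_j^i`). Let `e` be the vector of the function 1 and `β`
that of the data `φ_j(A_j)`. If `H ≥ 0` and `X_i* H X_i ≤ H` for all `i`, then adding a multiple of
`⟨H f(A), f(A)⟩` to the squared Hardy norm gives an admissible kernel. The bound on `R^k`, applied
by duality to the function 1, yields `⟨Hβ, β⟩ ≤ C² ⟨He, e⟩` in the limit where the added term
dominates (`re_dotProduct_entries_le`).

These inequalities say that `C² e e* - β β*` is nonnegative on all such `H`. Separation from a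
closed convex cone turns this into `C² e e* - β β* = Γ + ∑ᵢ (Γᵢ - Xᵢ Γᵢ Xᵢ*)` with positive
semidefinite `Γ`, `Γᵢ` (`exists_posSemidef_decomposition`). The cone is closed because the Lyapunov
inequalities have a strict solution (`exists_lyapunov`). A lurking contraction argument extracts a
contractive matrix `U` (`exists_realization`), and `F` is its transfer function.

For (1) take `C = 1` and the function `F`. For (2) take `C` to be the supremum, if finite, and `w =
C F(z)`: the adjoint of multiplication by `C F` on `H_k` restricts to the required extension, with
norm at most `C`. Conversely an extension is never smaller in norm than `R^k`, which also settles
the infinite case. -/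

/-! ### Torus integrals and matrix resolvents -/

theorem torusIntegral_eq_zero_of_circleIntegral_eq_zero {n : ℕ} {f : (Fin (n + 1) → ℂ) → ℂ}
    {c : Fin (n + 1) → ℂ} {R : Fin (n + 1) → ℝ} (hf : TorusIntegrable f c R) (i : Fin (n + 1))
    (h : ∀ Θ : Fin n → ℝ, circleIntegral (fun x => f (i.insertNth x
      (torusMap (c ∘ i.succAbove) (R ∘ i.succAbove) Θ))) (c i) (R i) = 0) :
    torusIntegral f c R = 0 := by
  set e : ℝ × (Fin n → ℝ) ≃ᵐ (Fin (n + 1) → ℝ) :=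
    (MeasurableEquiv.piFinSuccAbove (fun _ => ℝ) i).symm with he
  have hem : MeasureTheory.MeasurePreserving e :=
    (MeasureTheory.volume_preserving_piFinSuccAbove (fun _ : Fin (n + 1) => ℝ) i).symm _
  have heπ : (e ⁻¹' Set.Icc 0 fun _ => 2 * Real.pi) =
      Set.Icc 0 (2 * Real.pi) ×ˢ Set.Icc (0 : Fin n → ℝ) fun _ => 2 * Real.pi :=
    ((Fin.insertNthOrderIso (fun _ => ℝ) i).preimage_Icc _ _).trans (Set.Icc_prod_eq _ _)
  have hint := hf.function_integrable
  rw [← hem.integrableOn_comp_preimage e.measurableEmbedding, heπ,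
    MeasureTheory.Measure.volume_eq_prod] at hint
  rw [torusIntegral, ← hem.map_eq, MeasureTheory.setIntegral_map_equiv, heπ,
    MeasureTheory.Measure.volume_eq_prod, ← MeasureTheory.Measure.prod_restrict,
    MeasureTheory.integral_prod_symm _ (by rwa [MeasureTheory.Measure.prod_restrict])]
  refine MeasureTheory.integral_eq_zero_of_ae (Filter.Eventually.of_forall fun Θ => ?_)
  have h1 := h Θ
  rw [circleIntegral_def_Icc] at h1
  have h2 : ∀ θ : ℝ, (∏ j, (R j : ℂ) * Complex.exp (e (θ, Θ) j * Complex.I) * Complex.I) •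
      f (torusMap c R (e (θ, Θ))) =
      (∏ j, ((R (i.succAbove j) : ℂ) * Complex.exp (Θ j * Complex.I) * Complex.I)) *
      (deriv (circleMap (c i) (R i)) θ • f (i.insertNth (circleMap (c i) (R i) θ)
        (torusMap (c ∘ i.succAbove) (R ∘ i.succAbove) Θ))) := by
    intro θ
    have h3 : torusMap c R (e (θ, Θ)) = i.insertNth (circleMap (c i) (R i) θ)
        (torusMap (c ∘ i.succAbove) (R ∘ i.succAbove) Θ) := by
      simp [funext_iff, i.forall_iff_succAbove, circleMap, torusMap, e, Fin.insertNthEquiv]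
    rw [h3, i.prod_univ_succAbove, deriv_circleMap, circleMap_zero]
    simp only [e, MeasurableEquiv.piFinSuccAbove_symm_apply, Fin.insertNthEquiv, Equiv.coe_fn_mk,
      i.insertNth_apply_same, i.insertNth_apply_succAbove, smul_eq_mul]
    ring
  simp only [h2, MeasureTheory.integral_const_mul]
  rw [h1, mul_zero]
  rfl

theorem DifferentiableOn.matrix_det {E n : Type*} [NormedAddCommGroup E] [NormedSpace ℂ E]
    [Fintype n] [DecidableEq n] {s : Set E} {P : E → Matrix n n ℂ}
    (hP : ∀ i j, DifferentiableOn ℂ (fun w => P w i j) s) :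
    DifferentiableOn ℂ (fun w => (P w).det) s := by
  simp only [Matrix.det_apply]
  refine DifferentiableOn.fun_sum fun σ _ => ?_
  refine DifferentiableOn.const_smul ?_ _
  induction (Finset.univ : Finset n) using Finset.induction_on with
  | empty => simp
  | insert i t hi ih => simp only [Finset.prod_insert hi]; exact (hP _ _).fun_mul ih

theorem DifferentiableOn.matrix_inv_apply {E n : Type*} [NormedAddCommGroup E] [NormedSpace ℂ E]
    [Fintype n] [DecidableEq n] {s : Set E} {P : E → Matrix n n ℂ}
    (hP : ∀ i j, DifferentiableOn ℂ (fun w => P w i j) s) (hdet : ∀ w ∈ s, (P w).det ≠ 0)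
    (a b : n) : DifferentiableOn ℂ (fun w => (P w)⁻¹ a b) s := by
  simp only [Matrix.inv_def, Ring.inverse_eq_inv', Matrix.smul_apply, smul_eq_mul]
  refine ((DifferentiableOn.matrix_det hP).inv hdet).mul ?_
  simp only [Matrix.adjugate_apply]
  refine DifferentiableOn.matrix_det fun i j => ?_
  by_cases hi : i = b
  · subst hi; simp
  · simpa only [Matrix.updateRow_ne hi] using hP i j

/-- The inversion `w = ξ⁻¹` moves the singularities outside: `(ξ - M)⁻¹ = w (1 - w M)⁻¹`, and `(1 -
w M)⁻¹` is holomorphic for `|w| ≤ R⁻¹`. Cauchy's formula at `w = 0` then gives the identity. -/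
theorem circleIntegral_resolvent {m : ℕ} (M : Matrix (Fin m) (Fin m) ℂ) {R : ℝ} (hR : 0 < R)
    (hM : ∀ c : ℂ, R ≤ ‖c‖ → (c • (1 : Matrix (Fin m) (Fin m) ℂ) - M).det ≠ 0) (a b : Fin m) :
    circleIntegral (fun ξ => (ξ • (1 : Matrix (Fin m) (Fin m) ℂ) - M)⁻¹ a b) 0 R =
      2 * Real.pi * Complex.I * (1 : Matrix (Fin m) (Fin m) ℂ) a b := by
  let g : ℂ → ℂ := fun w => (1 - w • M)⁻¹ a b
  have hdet : ∀ w : ℂ, ‖w‖ ≤ R⁻¹ → (1 - w • M).det ≠ 0 := by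
    intro w hw
    rcases eq_or_ne w 0 with rfl | h0
    · simp
    · have h1 := hM w⁻¹ (by rw [norm_inv]; exact le_inv_of_le_inv₀ (by positivity) hw)
      have : (1 - w • M) = w • (w⁻¹ • (1 : Matrix (Fin m) (Fin m) ℂ) - M) := by
        rw [smul_sub, smul_smul, mul_inv_cancel₀ h0, one_smul]
      rw [this, Matrix.det_smul]
      exact mul_ne_zero (pow_ne_zero _ h0) h1
  have hg : DifferentiableOn ℂ g (Metric.closedBall 0 R⁻¹) := by
    refine DifferentiableOn.matrix_inv_apply (fun i j => ?_)
      (fun w hw => hdet w (by simpa using hw)) a b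
    simp only [Matrix.sub_apply, Matrix.smul_apply]; fun_prop
  have hinv : ∀ ξ : ℂ, ‖ξ‖ = R →
      (ξ • (1 : Matrix (Fin m) (Fin m) ℂ) - M)⁻¹ a b = ξ⁻¹ * g ξ⁻¹ := by
    intro ξ hξ
    have h0 : ξ ≠ 0 := by rw [← norm_pos_iff, hξ]; exact hR
    have hu : IsUnit (1 - ξ⁻¹ • M).det := isUnit_iff_ne_zero.mpr (hdet _ (by simp [hξ]))
    have : (ξ • (1 : Matrix (Fin m) (Fin m) ℂ) - M)⁻¹ = ξ⁻¹ • (1 - ξ⁻¹ • M)⁻¹ := by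
      refine Matrix.inv_eq_right_inv ?_
      have : ξ • (1 : Matrix (Fin m) (Fin m) ℂ) - M = ξ • (1 - ξ⁻¹ • M) := by
        rw [smul_sub, smul_smul, mul_inv_cancel₀ h0, one_smul]
      rw [this, Matrix.smul_mul, Matrix.mul_smul, Matrix.mul_nonsing_inv _ hu, smul_smul,
        mul_inv_cancel₀ h0, one_smul]
    rw [this, Matrix.smul_apply, smul_eq_mul]
  have hc := (hg.circleIntegral_sub_inv_smul (w := 0) (by simpa using hR))
  have hg0 : g 0 = (1 : Matrix (Fin m) (Fin m) ℂ) a b := by simp [g]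
  rw [hg0, smul_eq_mul] at hc
  rw [← hc, circleIntegral.integral_congr hR.le
    (g := fun ξ => ξ⁻¹ * g ξ⁻¹) fun ξ hξ => hinv ξ (by simpa using hξ)]
  simp only [circleIntegral, deriv_circleMap, sub_zero, smul_eq_mul]
  have hR' : (R : ℂ) ≠ 0 := by exact_mod_cast hR.ne'
  have h2 : ∀ (r : ℝ) (θ : ℝ), (r : ℂ) ≠ 0 → circleMap 0 r θ * Complex.I *
      ((circleMap 0 r θ)⁻¹ * g (circleMap 0 r θ)⁻¹) = Complex.I * g (circleMap 0 r θ)⁻¹ := by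
    intro r θ hr
    have : circleMap 0 r θ ≠ 0 := by simp [circleMap_zero, hr]
    field_simp
  have h3 : ∀ θ : ℝ, circleMap 0 R⁻¹ θ * Complex.I *
      ((circleMap 0 R⁻¹ θ)⁻¹ * g (circleMap 0 R⁻¹ θ)) = Complex.I * g (circleMap 0 R⁻¹ θ) := by
    intro θ
    have : circleMap 0 R⁻¹ θ ≠ 0 := by simp [circleMap_zero, hR']
    generalize circleMap 0 R⁻¹ θ = ζ at this
    field_simp
  simp only [fun θ => h2 R θ hR', h3]
  -- Inversion reverses the orientation of the circle, which the substitution `θ ↦ 2π - θ` undoes.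
  have h4 := intervalIntegral.integral_comp_sub_left (a := 0) (b := 2 * Real.pi)
    (fun θ => Complex.I * g (circleMap 0 R θ)⁻¹) (2 * Real.pi)
  rw [sub_self, sub_zero] at h4
  rw [← h4]
  refine intervalIntegral.integral_congr fun θ _ => ?_
  have h5 : (circleMap 0 R (2 * Real.pi - θ))⁻¹ = circleMap 0 R⁻¹ θ := by
    rw [circleMap_zero, circleMap_zero, mul_inv, ← Complex.exp_neg]
    push_cast
    rw [show -((2 * (Real.pi : ℂ) - θ) * Complex.I) = θ * Complex.I - 2 * Real.pi * Complex.I by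
      ring, Complex.exp_sub, Complex.exp_two_pi_mul_I, div_one]
  simp only [h5]

theorem continuousOn_resolventProd_of_det_ne_zero {d m : ℕ}
    {M : Fin d → Matrix (Fin m) (Fin m) ℂ} {s : Set (Fin d → ℂ)}
    (hM : ∀ i, ∀ ξ ∈ s, (ξ i • (1 : Matrix (Fin m) (Fin m) ℂ) - M i).det ≠ 0) :
    ContinuousOn (resolventProd M) s := by
  have h : ∀ i : Fin d, ContinuousOn (fun ξ : Fin d → ℂ =>
      (ξ i • (1 : Matrix (Fin m) (Fin m) ℂ) - M i)⁻¹) s := by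
    intro i
    have hc : Continuous fun ξ : Fin d → ℂ => ξ i • (1 : Matrix (Fin m) (Fin m) ℂ) - M i := by
      fun_prop
    simp only [Matrix.inv_def, Ring.inverse_eq_inv']
    exact (hc.matrix_det.continuousOn.inv₀ (hM i)).smul hc.matrix_adjugate.continuousOn
  unfold resolventProd
  simp only [List.ofFn_eq_map]
  exact continuousOn_list_prod _ fun i _ => h i

theorem resolventProd_cons {d m : ℕ} (M : Fin (d + 1) → Matrix (Fin m) (Fin m) ℂ) (x : ℂ)
    (y : Fin d → ℂ) : resolventProd M (Fin.cons x y) =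
      (x • (1 : Matrix (Fin m) (Fin m) ℂ) - M 0)⁻¹ * resolventProd (fun i => M i.succ) y := by
  simp [resolventProd, List.ofFn_succ]

theorem norm_torusMap_zero {d : ℕ} {R : ℝ} (hR : 0 ≤ R) (θ : Fin d → ℝ) (i : Fin d) :
    ‖torusMap 0 (fun _ => R) θ i‖ = R := by
  simp [torusMap, Complex.norm_exp_ofReal_mul_I, abs_of_nonneg hR]

theorem ContinuousOn.torusIntegrable {d : ℕ} {R : ℝ} (hR : 0 ≤ R) {f : (Fin d → ℂ) → ℂ}
    (hf : ContinuousOn f {z | ∀ i, ‖z i‖ = R}) : TorusIntegrable f 0 (fun _ => R) :=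
  (hf.comp_continuous (continuous_torusMap_zero _) (norm_torusMap_zero hR)).integrableOn_Icc

theorem torusIntegral_resolventProd {m : ℕ} {R : ℝ} (hR : 0 < R) {d : ℕ}
    (M : Fin d → Matrix (Fin m) (Fin m) ℂ)
    (hM : ∀ i, ∀ c : ℂ, R ≤ ‖c‖ → (c • (1 : Matrix (Fin m) (Fin m) ℂ) - M i).det ≠ 0)
    (a b : Fin m) :
    torusIntegral (fun ξ => resolventProd M ξ a b) 0 (fun _ => R) =
      (2 * Real.pi * Complex.I) ^ d * (1 : Matrix (Fin m) (Fin m) ℂ) a b := by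
  induction d generalizing a b with
  | zero => simp [resolventProd]
  | succ d ih =>
    have hint : ∀ (d : ℕ) (M : Fin d → Matrix (Fin m) (Fin m) ℂ)
        (_ : ∀ i, ∀ c : ℂ, R ≤ ‖c‖ → (c • (1 : Matrix (Fin m) (Fin m) ℂ) - M i).det ≠ 0)
        (a b : Fin m), TorusIntegrable (fun ξ => resolventProd M ξ a b) 0 (fun _ => R) :=
      fun d M hM a b => ContinuousOn.torusIntegrable hR.le
        ((continuous_apply_apply a b).comp_continuousOn
          (continuousOn_resolventProd_of_det_ne_zero fun i ξ hξ => hM i _ (hξ i).ge))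
    rw [torusIntegral_succ (hint _ M hM a b)]
    simp only [resolventProd_cons, Matrix.mul_apply]
    have h1 : ∀ x : ℂ, torusIntegral (fun y => ∑ c,
        (x • (1 : Matrix (Fin m) (Fin m) ℂ) - M 0)⁻¹ a c *
          resolventProd (fun i => M i.succ) y c b) ((0 : Fin (d + 1) → ℂ) ∘ Fin.succ)
          ((fun _ => R) ∘ Fin.succ) =
        (2 * Real.pi * Complex.I) ^ d * (x • (1 : Matrix (Fin m) (Fin m) ℂ) - M 0)⁻¹ a b := by
      intro x
      change torusIntegral (fun y => ∑ c, (x • (1 : Matrix (Fin m) (Fin m) ℂ) - M 0)⁻¹ a c *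
          resolventProd (fun i => M i.succ) y c b) 0 (fun _ => R) = _
      have h2 : ∀ c, torusIntegral (fun y =>
          (x • (1 : Matrix (Fin m) (Fin m) ℂ) - M 0)⁻¹ a c *
          resolventProd (fun i => M i.succ) y c b) 0 (fun _ => R) = _ := fun c => by
        rw [torusIntegral_const_mul, ih (fun i => M i.succ) (fun i => hM i.succ)]
      have h3 := fun c => (hint _ (fun i => M i.succ) (fun i => hM i.succ) c b).function_integrable
      simp only [torusIntegral, Finset.smul_sum] at h2 ⊢
      rw [MeasureTheory.integral_finsetSum]
      · simp only [h2, Matrix.one_apply]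
        simp [mul_comm]
      · intro c _
        simp only [smul_eq_mul, mul_left_comm _ ((x • (1 : Matrix (Fin m) (Fin m) ℂ) - M 0)⁻¹ a c)]
        exact (h3 c).const_mul _
    simp only [h1]
    rw [circleIntegral.integral_const_mul]
    change _ * circleIntegral _ 0 R = _
    rw [circleIntegral_resolvent (M 0) hR (hM 0)]
    ring

/-- Serves to cancel `ξ_i - M_i` against the `i`-th factor of the product of resolvents. -/
theorem mul_prod_ofFn {α : Type*} [Monoid α] {d : ℕ} (h : Fin d → α) (x : α)
    (hx : ∀ j, Commute x (h j)) (i : Fin d) :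
    x * (List.ofFn h).prod = (List.ofFn (Function.update h i (x * h i))).prod := by
  induction d with
  | zero => exact i.elim0
  | succ d ih =>
    rw [List.ofFn_succ, List.ofFn_succ, List.prod_cons, List.prod_cons]
    refine Fin.cases ?_ (fun i => ?_) i
    · simp [mul_assoc]
    · have h1 : (fun j : Fin d => Function.update h i.succ (x * h i.succ) j.succ) =
          Function.update (fun j : Fin d => h j.succ) i (x * h i.succ) := by
        ext j
        by_cases hj : j = i
        · subst hj; simp
        · simp [Function.update_of_ne, hj]
      rw [h1, ← ih (fun j => h j.succ) (fun j => hx j.succ) i,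
        Function.update_of_ne (Fin.succ_ne_zero i).symm,
        ← mul_assoc, (hx 0).eq, mul_assoc]

/-! ### The functional calculus of a node -/

section node

variable {d m : ℕ} {M : Fin d → Matrix (Fin m) (Fin m) ℂ}

theorem IsNode.evalRadius_pos (hM : IsNode M) : 0 < evalRadius M := by
  have := hM.sSup_lt_one; unfold evalRadius; linarith

theorem IsNode.evalRadius_lt_one (hM : IsNode M) : evalRadius M < 1 := by
  have := hM.sSup_lt_one; unfold evalRadius; linarith

theorem IsNode.det_ne_zero_of_le (hM : IsNode M) (i : Fin d) (c : ℂ) (hc : evalRadius M ≤ ‖c‖) :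
    (c • (1 : Matrix (Fin m) (Fin m) ℂ) - M i).det ≠ 0 := by
  intro h
  obtain ⟨lam, hlam, rfl⟩ := exists_mem_jointSpectrum hM.commute i c h
  have h1 : ‖lam‖ ≤ sSup (norm '' jointSpectrum M) :=
    le_csSup ((finite_jointSpectrum M).image norm).bddAbove ⟨lam, hlam, rfl⟩
  have h2 := norm_le_pi_norm lam i
  have h3 := hM.sSup_lt_one
  rw [evalRadius] at hc
  linarith

theorem IsNode.mem_polydisc (hM : IsNode M) {ξ : Fin d → ℂ} (hξ : ∀ i, ‖ξ i‖ = evalRadius M) :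
    ξ ∈ polydisc d := fun i => (hξ i).trans_lt hM.evalRadius_lt_one

theorem IsNode.torusIntegrable_mul (hM : IsNode M) {f : (Fin d → ℂ) → ℂ}
    (hf : DifferentiableOn ℂ f (polydisc d)) (a b : Fin m) :
    TorusIntegrable (fun ξ => f ξ * resolventProd M ξ a b) 0 (fun _ => evalRadius M) :=
  ContinuousOn.torusIntegrable hM.evalRadius_pos.le
    ((hf.continuousOn.mono fun _ => hM.mem_polydisc).mul
      ((continuous_apply_apply a b).comp_continuousOn hM.continuousOn_resolventProd))

theorem torusIntegral_congr_of_norm_eq {R : ℝ} (hR : 0 ≤ R) {f g : (Fin d → ℂ) → ℂ}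
    (h : ∀ ξ : Fin d → ℂ, (∀ i, ‖ξ i‖ = R) → f ξ = g ξ) :
    torusIntegral f 0 (fun _ => R) = torusIntegral g 0 (fun _ => R) := by
  unfold torusIntegral
  congr 1
  ext θ
  rw [h _ (norm_torusMap_zero hR θ)]

theorem IsNode.matEval_congr (hM : IsNode M) {f g : (Fin d → ℂ) → ℂ}
    (h : Set.EqOn f g (polydisc d)) : matEval f M = matEval g M := by
  ext a b
  simp only [matEval, Matrix.of_apply]
  rw [torusIntegral_congr_of_norm_eq hM.evalRadius_pos.le
    fun ξ hξ => by rw [h (hM.mem_polydisc hξ)]]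

theorem IsNode.matEval_add (hM : IsNode M) {f g : (Fin d → ℂ) → ℂ}
    (hf : DifferentiableOn ℂ f (polydisc d)) (hg : DifferentiableOn ℂ g (polydisc d)) :
    matEval (fun z => f z + g z) M = matEval f M + matEval g M := by
  ext a b
  simp only [matEval, Matrix.of_apply, Matrix.add_apply, add_mul]
  rw [torusIntegral_add (hM.torusIntegrable_mul hf a b) (hM.torusIntegrable_mul hg a b), mul_add]

theorem matEval_const_mul (c : ℂ) (f : (Fin d → ℂ) → ℂ) :
    matEval (fun z => c * f z) M = c • matEval f M := by
  ext a b
  simp only [matEval, Matrix.of_apply, Matrix.smul_apply, mul_assoc]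
  rw [torusIntegral_const_mul, smul_eq_mul]
  ring

theorem matEval_zero : matEval (fun _ => 0) M = 0 := by
  simpa using matEval_const_mul (M := M) 0 (fun _ => 0)

theorem IsNode.matEval_sum (hM : IsNode M) {κ : Type*} (s : Finset κ)
    {f : κ → (Fin d → ℂ) → ℂ} (hf : ∀ t, DifferentiableOn ℂ (f t) (polydisc d)) :
    matEval (fun z => ∑ t ∈ s, f t z) M = ∑ t ∈ s, matEval (f t) M := by
  classical
  induction s using Finset.induction_on with
  | empty => simpa using matEval_zero
  | insert t s ht ih =>
    simp only [Finset.sum_insert ht]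
    rw [hM.matEval_add (hf t) (DifferentiableOn.fun_sum fun t _ => hf t), ih]

theorem IsNode.matEval_one (hM : IsNode M) : matEval (fun _ => 1) M = 1 := by
  ext a b
  simp only [matEval, Matrix.of_apply, one_mul]
  rw [torusIntegral_resolventProd hM.evalRadius_pos M hM.det_ne_zero_of_le, ← mul_assoc,
    inv_mul_cancel₀, one_mul]
  simp [Real.pi_ne_zero]

theorem Commute.matrix_inv_right {n : Type*} [Fintype n] [DecidableEq n] {x P : Matrix n n ℂ}
    (h : Commute x P) : Commute x P⁻¹ := by
  by_cases hP : IsUnit P.det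
  · calc x * P⁻¹ = P⁻¹ * (P * x) * P⁻¹ := by
          rw [← Matrix.mul_assoc P⁻¹, Matrix.nonsing_inv_mul _ hP, Matrix.one_mul]
      _ = P⁻¹ * x := by
          rw [← h.eq, Matrix.mul_assoc, Matrix.mul_assoc, Matrix.mul_nonsing_inv _ hP,
            Matrix.mul_one]
  · rw [Matrix.nonsing_inv_apply_not_isUnit _ hP]
    exact Commute.zero_right x

theorem commute_resolvent (ξ : Fin d → ℂ) (x : Matrix (Fin m) (Fin m) ℂ)
    (hx : ∀ j, Commute x (M j)) (j : Fin d) :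
    Commute x (ξ j • (1 : Matrix (Fin m) (Fin m) ℂ) - M j)⁻¹ := by
  have h : Commute x (ξ j • (1 : Matrix (Fin m) (Fin m) ℂ) - M j) :=
    ((Commute.one_right x).smul_right _).sub_right (hx j)
  exact h.matrix_inv_right

theorem IsNode.sub_mul_resolventProd (hM : IsNode M) {ξ : Fin d → ℂ}
    (hξ : ∀ i, ‖ξ i‖ = evalRadius M) (i : Fin d) :
    (ξ i • (1 : Matrix (Fin m) (Fin m) ℂ) - M i) * resolventProd M ξ =
      (List.ofFn (Function.update
        (fun j => (ξ j • (1 : Matrix (Fin m) (Fin m) ℂ) - M j)⁻¹) i 1)).prod := by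
  rw [resolventProd, mul_prod_ofFn _ _ (fun j => ?_) i, Matrix.mul_nonsing_inv]
  · exact isUnit_iff_ne_zero.mpr (hM.det_ne_zero i (hξ i))
  · refine commute_resolvent ξ _ (fun j => ?_) j
    exact ((Commute.one_left _).smul_left _).sub_left (hM.commute i j)

theorem IsNode.commute_resolventProd (hM : IsNode M) (ξ : Fin d → ℂ) (i : Fin d) :
    Commute (M i) (resolventProd M ξ) := by
  unfold resolventProd
  refine Commute.list_prod_right _ _ fun x hx => ?_
  obtain ⟨j, rfl⟩ := (List.mem_ofFn' _ _).mp hx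
  exact commute_resolvent ξ _ (hM.commute i) j

/-- Once `ξ_i - M_i` has cancelled its resolvent, the integrand is holomorphic in `ξ_i` on the whole
disc, so Cauchy's theorem in that variable applies. -/
theorem IsNode.torusIntegral_sub_mul_resolventProd (hM : IsNode M) {f : (Fin d → ℂ) → ℂ}
    (hf : DifferentiableOn ℂ f (polydisc d)) (i : Fin d) (a b : Fin m) :
    torusIntegral (fun ξ => f ξ * ((ξ i • (1 : Matrix (Fin m) (Fin m) ℂ) - M i) *
      resolventProd M ξ) a b) 0 (fun _ => evalRadius M) = 0 := by
  obtain _ | n := d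
  · exact i.elim0
  have hR := hM.evalRadius_pos
  refine torusIntegral_eq_zero_of_circleIntegral_eq_zero ?_ i fun Θ => ?_
  · refine ContinuousOn.torusIntegrable hR.le ?_
    refine (hf.continuousOn.mono fun _ => hM.mem_polydisc).mul
      ((continuous_apply_apply a b).comp_continuousOn ?_)
    exact ContinuousOn.mul (by fun_prop) hM.continuousOn_resolventProd
  · set y := torusMap ((0 : Fin (n + 1) → ℂ) ∘ i.succAbove) ((fun _ => evalRadius M) ∘ i.succAbove) Θ
      with hy
    have hyn : ∀ j, ‖y j‖ = evalRadius M := norm_torusMap_zero hR.le Θ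
    -- The remaining product does not involve the `i`-th coordinate, which is therefore set to 0.
    let P : Matrix (Fin m) (Fin m) ℂ := (List.ofFn (Function.update
        (fun j => ((i.insertNth 0 y : Fin (n + 1) → ℂ) j •
          (1 : Matrix (Fin m) (Fin m) ℂ) - M j)⁻¹) i 1)).prod
    have h1 : Set.EqOn (fun x => f (i.insertNth x y) *
        (((i.insertNth x y : Fin (n + 1) → ℂ) i • (1 : Matrix (Fin m) (Fin m) ℂ) - M i) *
          resolventProd M (i.insertNth x y)) a b)
        (fun x => f (i.insertNth x y) * P a b) (Metric.sphere 0 (evalRadius M)) := by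
      intro x hx
      have hx : ‖x‖ = evalRadius M := by simpa using hx
      simp only [P]
      rw [hM.sub_mul_resolventProd (by simp [i.forall_iff_succAbove, hx, hyn])]
      congr 1
      refine congrArg (fun h : Fin (n + 1) → Matrix (Fin m) (Fin m) ℂ =>
        (List.ofFn h).prod a b) (funext fun j => ?_)
      rcases Fin.eq_self_or_eq_succAbove i j with rfl | ⟨j, rfl⟩
      · simp
      · simp [Function.update_of_ne, Fin.succAbove_ne]
    rw [Pi.zero_apply, circleIntegral.integral_congr hR.le h1]
    refine Complex.circleIntegral_eq_zero_of_differentiable_on_off_countable hR.le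
      Set.countable_empty ?_ ?_
    · refine ContinuousOn.mul (hf.continuousOn.comp (by fun_prop) fun x hx => ?_) (by fun_prop)
      have hx : ‖x‖ ≤ evalRadius M := by simpa using hx
      simp [polydisc, i.forall_iff_succAbove, hx.trans_lt hM.evalRadius_lt_one, hyn,
        hM.evalRadius_lt_one]
    · intro x hx
      have hx : ‖x‖ < evalRadius M := by simpa using hx.1
      refine DifferentiableAt.mul ?_ (by fun_prop)
      have hmem : i.insertNth x y ∈ polydisc (n + 1) := by
        simp [polydisc, i.forall_iff_succAbove, hx.trans hM.evalRadius_lt_one, hyn,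
          hM.evalRadius_lt_one]
      have ho : IsOpen (polydisc (n + 1)) := by
        have : polydisc (n + 1) = ⋂ i, {z | ‖z i‖ < 1} := by ext; simp [polydisc]
        rw [this]
        exact isOpen_iInter_of_finite fun i => isOpen_lt (by fun_prop) (by fun_prop)
      refine (hf.differentiableAt (ho.mem_nhds hmem)).comp x ?_
      rw [differentiableAt_pi, i.forall_iff_succAbove]
      simp

theorem differentiableOn_coord_mul {f : (Fin d → ℂ) → ℂ}
    (hf : DifferentiableOn ℂ f (polydisc d)) (i : Fin d) :
    DifferentiableOn ℂ (fun z => z i * f z) (polydisc d) :=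
  DifferentiableOn.mul (by fun_prop) hf

theorem torusIntegral_sum_const_mul {R : ℝ} {κ : Type*} (s : Finset κ) (x : κ → ℂ)
    {f : κ → (Fin d → ℂ) → ℂ} (hf : ∀ c, TorusIntegrable (f c) 0 (fun _ => R)) :
    TorusIntegrable (fun ξ => ∑ c ∈ s, x c * f c ξ) 0 (fun _ => R) ∧
      torusIntegral (fun ξ => ∑ c ∈ s, x c * f c ξ) 0 (fun _ => R) =
        ∑ c ∈ s, x c * torusIntegral (f c) 0 (fun _ => R) := by
  have h2 : ∀ c, TorusIntegrable (fun ξ => x c * f c ξ) 0 (fun _ => R) :=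
    fun c => (hf c).const_mul _
  refine ⟨MeasureTheory.integrable_finsetSum _ fun c _ => h2 c, ?_⟩
  simp only [← torusIntegral_const_mul]
  simp only [torusIntegral, Finset.smul_sum]
  rw [MeasureTheory.integral_finsetSum]
  exact fun c _ => (h2 c).function_integrable

/-- Write `ξ_i = (ξ_i - M_i) + M_i`; the first summand integrates to zero. This is the basic case of
multiplicativity from which everything later is derived. -/
theorem IsNode.matEval_coord_mul (hM : IsNode M) {f : (Fin d → ℂ) → ℂ}
    (hf : DifferentiableOn ℂ f (polydisc d)) (i : Fin d) :
    matEval (fun z => z i * f z) M = M i * matEval f M := by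
  ext a b
  have h0 := hM.torusIntegral_sub_mul_resolventProd hf i a b
  have h1 : (fun ξ => f ξ * ((ξ i • (1 : Matrix (Fin m) (Fin m) ℂ) - M i) *
      resolventProd M ξ) a b) = fun ξ => (ξ i * f ξ) * resolventProd M ξ a b -
        ∑ c, M i a c * (f ξ * resolventProd M ξ c b) := by
    ext ξ
    rw [Matrix.sub_mul, Matrix.smul_mul, Matrix.one_mul, Matrix.sub_apply, Matrix.smul_apply,
      Matrix.mul_apply, mul_sub, Finset.mul_sum, smul_eq_mul]
    congr 1
    · ring
    · exact Finset.sum_congr rfl fun c _ => by ring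
  obtain ⟨h3, h4⟩ := torusIntegral_sum_const_mul Finset.univ (M i a)
    fun c => hM.torusIntegrable_mul hf c b
  rw [h1, torusIntegral_sub (hM.torusIntegrable_mul (differentiableOn_coord_mul hf i) a b) h3,
    sub_eq_zero, h4] at h0
  simp only [matEval, Matrix.of_apply, Matrix.mul_apply, h0, Finset.mul_sum]
  exact Finset.sum_congr rfl fun c _ => by ring

theorem IsNode.commute_matEval (hM : IsNode M) {f : (Fin d → ℂ) → ℂ}
    (hf : DifferentiableOn ℂ f (polydisc d)) (i : Fin d) : Commute (M i) (matEval f M) := by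
  ext a b
  have h1 := (torusIntegral_sum_const_mul Finset.univ (M i a)
    fun c => hM.torusIntegrable_mul hf c b).2
  have h2 := (torusIntegral_sum_const_mul Finset.univ (fun c => M i c b)
    fun c => hM.torusIntegrable_mul hf a c).2
  have h3 : (fun ξ => ∑ c, M i a c * (f ξ * resolventProd M ξ c b)) =
      fun ξ => ∑ c, M i c b * (f ξ * resolventProd M ξ a c) := by
    ext ξ
    have h := congrArg (fun P => f ξ * P a b) (hM.commute_resolventProd ξ i).eq
    simp only [Matrix.mul_apply, Finset.mul_sum] at h
    convert h using 2 <;> ring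
  rw [h3, h2] at h1
  have h4 := congrArg (fun x => ((2 * (Real.pi : ℂ) * Complex.I) ^ d)⁻¹ * x) h1
  simp only [matEval, Matrix.of_apply, Matrix.mul_apply, Finset.mul_sum] at h4 ⊢
  convert h4.symm using 2 <;> ring

theorem IsNode.matEval_coord_pow (hM : IsNode M) (i : Fin d) (n : ℕ) :
    matEval (fun z => z i ^ n) M = M i ^ n := by
  induction n with
  | zero => simpa using hM.matEval_one
  | succ n ih =>
    simp only [pow_succ']
    rw [hM.matEval_coord_mul (f := fun z => z i ^ n) (by fun_prop), ih]

/-- The Cauchy integral for `M_i ^ n` is over a torus of radius `r < 1`, so its entries are `O(r ^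
n)`. -/
theorem IsNode.tendsto_pow (hM : IsNode M) (i : Fin d) :
    Filter.Tendsto (fun n => M i ^ n) Filter.atTop (nhds 0) := by
  refine tendsto_pi_nhds.mpr fun a => tendsto_pi_nhds.mpr fun b => ?_
  obtain ⟨C, hC⟩ := (isCompact_torus (d := d) (evalRadius M)).exists_bound_of_continuousOn
    ((continuous_apply_apply a b).comp_continuousOn hM.continuousOn_resolventProd)
  have hb : ∀ n, ‖(M i ^ n) a b‖ ≤ ‖((2 * (Real.pi : ℂ) * Complex.I) ^ d)⁻¹‖ *
      (((2 * Real.pi) ^ d * ∏ _i : Fin d, |evalRadius M|) * (evalRadius M ^ n * C)) := by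
    intro n
    rw [← hM.matEval_coord_pow, matEval, Matrix.of_apply, norm_mul]
    refine mul_le_mul_of_nonneg_left ?_ (norm_nonneg _)
    refine norm_torusIntegral_le_of_norm_le_const fun θ => ?_
    have hθ := norm_torusMap_zero (d := d) hM.evalRadius_pos.le θ
    rw [norm_mul, norm_pow, hθ i]
    exact mul_le_mul_of_nonneg_left (hC _ hθ) (pow_nonneg hM.evalRadius_pos.le n)
  refine squeeze_zero_norm hb ?_
  have h0 := tendsto_pow_atTop_nhds_zero_of_lt_one hM.evalRadius_pos.le hM.evalRadius_lt_one
  simpa using ((h0.mul_const C).const_mul _).const_mul _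

end node

/-! ### Duality for the cone of Lyapunov inequalities -/

section cone

open scoped ComplexOrder

variable {ι τ : Type*} [Fintype ι] [Fintype τ]

theorem Matrix.PosSemidef.exists_eq_conjTranspose_mul_self {P : Matrix ι ι ℂ} (hP : P.PosSemidef) :
    ∃ B : Matrix ι ι ℂ, P = Bᴴ * B := by
  classical
  open scoped MatrixOrder in
  exact CStarAlgebra.nonneg_iff_eq_star_mul_self.mp hP.nonneg

theorem Matrix.PosSemidef.trace_mul_nonneg {P Q : Matrix ι ι ℂ} (hP : P.PosSemidef)
    (hQ : Q.PosSemidef) : 0 ≤ (P * Q).trace.re := by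
  obtain ⟨B, rfl⟩ := hP.exists_eq_conjTranspose_mul_self
  rw [Matrix.mul_assoc, Matrix.trace_mul_comm]
  exact (Complex.le_def.mp (hQ.mul_mul_conjTranspose_same B).trace_nonneg).1

theorem Matrix.PosSemidef.norm_apply_le_trace {P : Matrix ι ι ℂ} (hP : P.PosSemidef) (a b : ι) :
    ‖P a b‖ ≤ P.trace.re := by
  obtain ⟨B, rfl⟩ := hP.exists_eq_conjTranspose_mul_self
  have htr : (Bᴴ * B).trace.re = ∑ a, ∑ c, ‖B c a‖ ^ 2 := by
    simp only [Matrix.trace, Matrix.diag, Matrix.mul_apply, Matrix.conjTranspose_apply,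
      Complex.re_sum]
    refine Finset.sum_congr rfl fun a _ => Finset.sum_congr rfl fun c _ => ?_
    rw [← Complex.normSq_eq_norm_sq, Complex.normSq_apply]
    simp [Complex.mul_re]
  have hle : ∀ a, ∑ c, ‖B c a‖ ^ 2 ≤ (Bᴴ * B).trace.re := fun a => by
    rw [htr]
    exact Finset.single_le_sum (f := fun a => ∑ c, ‖B c a‖ ^ 2)
      (fun a _ => Finset.sum_nonneg fun c _ => by positivity) (Finset.mem_univ a)
  have h1 : ‖(Bᴴ * B) a b‖ ≤ ∑ c, (‖B c a‖ ^ 2 + ‖B c b‖ ^ 2) / 2 := by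
    rw [Matrix.mul_apply]
    refine (norm_sum_le _ _).trans (Finset.sum_le_sum fun c _ => ?_)
    rw [norm_mul, Matrix.conjTranspose_apply, norm_star]
    nlinarith [sq_nonneg (‖B c a‖ - ‖B c b‖)]
  rw [← Finset.sum_div, Finset.sum_add_distrib] at h1
  linarith [hle a, hle b]

/-- Under the trace pairing, `Γ ↦ Γ - X Γ X*` and `H ↦ H - X* H X` are adjoint to each other; this
is the duality behind the decomposition. -/
theorem trace_sub_conj (X H Γ : Matrix ι ι ℂ) :
    (H * (Γ - X * Γ * Xᴴ)).trace = ((H - Xᴴ * H * X) * Γ).trace := by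
  have h : H * (X * Γ * Xᴴ) = (H * X * Γ) * Xᴴ := by simp only [Matrix.mul_assoc]
  rw [Matrix.mul_sub, Matrix.sub_mul, Matrix.trace_sub, Matrix.trace_sub, h,
    Matrix.trace_mul_comm _ Xᴴ]
  simp only [Matrix.mul_assoc]

/-- Lets a separating functional, whose matrix need not be Hermitian, be replaced by a Hermitian
one. -/
theorem re_trace_symm (H T : Matrix ι ι ℂ) (hT : T.IsHermitian) :
    ((((1 / 2 : ℝ) : ℂ) • (H + Hᴴ)) * T).trace.re = (H * T).trace.re := by
  have h : (Hᴴ * T).trace.re = (H * T).trace.re := by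
    have : (Hᴴ * T).trace = star (H * T).trace := by
      rw [← Matrix.trace_conjTranspose, Matrix.conjTranspose_mul, hT.eq, Matrix.trace_mul_comm]
    rw [this]; simp
  rw [Matrix.smul_mul, Matrix.trace_smul, Matrix.add_mul, Matrix.trace_add, smul_eq_mul,
    Complex.re_ofReal_mul, Complex.add_re, h]
  ring

theorem trace_mul_vecMulVec_star (H : Matrix ι ι ℂ) (v : ι → ℂ) :
    (H * Matrix.vecMulVec v (star v)).trace = star v ⬝ᵥ (H *ᵥ v) := by
  rw [Matrix.mul_vecMulVec, Matrix.trace_vecMulVec, dotProduct_comm]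

attribute [local instance] Matrix.normedAddCommGroup Matrix.normedSpace

theorem isCompact_posSemidef_trace_le (c : ℝ) :
    IsCompact {Γ : τ → Matrix ι ι ℂ | (∀ t, (Γ t).PosSemidef) ∧ ∑ t, (Γ t).trace.re ≤ c} := by
  refine Metric.isCompact_of_isClosed_isBounded ?_ ?_
  · have : {Γ : τ → Matrix ι ι ℂ | (∀ t, (Γ t).PosSemidef) ∧ ∑ t, (Γ t).trace.re ≤ c} =
        (⋂ t, {Γ | (Γ t)ᴴ = Γ t} ∩ ⋂ x : ι → ℂ, {Γ | 0 ≤ star x ⬝ᵥ (Γ t *ᵥ x)}) ∩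
          {Γ | ∑ t, (Γ t).trace.re ≤ c} := by
      ext Γ
      simp only [Set.mem_ofPred_eq, Set.mem_inter_iff, Set.mem_iInter,
        Matrix.posSemidef_iff_dotProduct_mulVec, Matrix.IsHermitian]
    rw [this]
    refine (isClosed_iInter fun t => IsClosed.inter ?_ (isClosed_iInter fun x => ?_)).inter ?_
    · exact isClosed_eq (by fun_prop) (by fun_prop)
    · exact isClosed_le (by fun_prop) (by fun_prop)
    · refine isClosed_le (continuous_finsetSum _ fun t _ => ?_) continuous_const
      exact Complex.continuous_re.comp (by fun_prop)
  · refine (Metric.isBounded_iff_subset_closedBall 0).mpr ⟨max c 0, fun Γ hΓ => ?_⟩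
    rw [mem_closedBall_zero_iff, pi_norm_le_iff_of_nonneg (le_max_right _ _)]
    intro t
    rw [Matrix.norm_le_iff (le_max_right _ _)]
    intro a b
    have h0 : ∀ t, 0 ≤ (Γ t).trace.re := fun t => (Complex.le_def.mp (hΓ.1 t).trace_nonneg).1
    exact (((hΓ.1 t).norm_apply_le_trace a b).trans (Finset.single_le_sum
      (f := fun t => (Γ t).trace.re) (fun t _ => h0 t) (Finset.mem_univ t))).trans
        (hΓ.2.trans (le_max_left _ _))

/-- A Hermitian matrix `T` on which every solution `H` of the Lyapunov inequalities
`X tᴴ * H * X t ≤ H` is nonnegative is a sum of matrices `Γ t - X t * Γ t * X tᴴ` with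
`Γ t` positive semidefinite, provided that the Lyapunov inequalities have a strict solution. -/
theorem exists_posSemidef_decomposition [DecidableEq ι] (X : τ → Matrix ι ι ℂ) (T : Matrix ι ι ℂ)
    (hT : T.IsHermitian) (H₀ : Matrix ι ι ℂ)
    (hH₀ : ∀ t, (H₀ - (X t)ᴴ * H₀ * X t - 1).PosSemidef)
    (h : ∀ H : Matrix ι ι ℂ, (∀ t, (H - (X t)ᴴ * H * X t).PosSemidef) → 0 ≤ (H * T).trace.re) :
    ∃ Γ : τ → Matrix ι ι ℂ, (∀ t, (Γ t).PosSemidef) ∧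
      T = ∑ t, (Γ t - X t * Γ t * (X t)ᴴ) := by
  classical
  let L : (τ → Matrix ι ι ℂ) → Matrix ι ι ℂ := fun Γ => ∑ t, (Γ t - X t * Γ t * (X t)ᴴ)
  let S : Set (τ → Matrix ι ι ℂ) := {Γ | ∀ t, (Γ t).PosSemidef}
  have hL : Continuous L := by fun_prop
  -- Pairing with the strict solution `H₀` bounds `∑ tr Γ t` by `q (L Γ)`. Near a limit point `x`
  -- the preimages thus lie in a compact set, whose image is closed.
  have hK : IsClosed (L '' S) := by
    refine isClosed_of_closure_subset fun x hx => ?_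
    let q : Matrix ι ι ℂ → ℝ := fun y => (H₀ * y).trace.re
    have hq : Continuous q := Complex.continuous_re.comp (by fun_prop)
    have h1 : ∀ Γ ∈ S, ∑ t, (Γ t).trace.re ≤ q (L Γ) := by
      intro Γ hΓ
      simp only [q, L, Finset.mul_sum, Matrix.trace_sum, Complex.re_sum, trace_sub_conj]
      refine Finset.sum_le_sum fun t _ => ?_
      have := (hH₀ t).trace_mul_nonneg (hΓ t)
      rw [Matrix.sub_mul, Matrix.trace_sub, Matrix.one_mul, Complex.sub_re] at this
      linarith
    have hU : IsOpen {y | q y < q x + 1} := isOpen_lt hq continuous_const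
    have h2 : x ∈ closure ({y | q y < q x + 1} ∩ L '' S) :=
      hU.inter_closure ⟨by simp, hx⟩
    have h3 := ((isCompact_posSemidef_trace_le (ι := ι) (τ := τ) (q x + 1)).image hL).isClosed
    have h4 : {y | q y < q x + 1} ∩ L '' S ⊆ L '' {Γ : τ → Matrix ι ι ℂ |
        (∀ t, (Γ t).PosSemidef) ∧ ∑ t, (Γ t).trace.re ≤ q x + 1} := by
      rintro _ ⟨hy, Γ, hΓ, rfl⟩
      exact ⟨Γ, ⟨hΓ, (h1 Γ hΓ).trans hy.le⟩, rfl⟩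
    obtain ⟨Γ, hΓ, rfl⟩ := h3.closure_subset_iff.mpr h4 h2
    exact ⟨Γ, hΓ.1, rfl⟩
  have hS : ∀ Γ ∈ S, ∀ Γ' ∈ S, ∀ a b : ℝ, 0 ≤ a → 0 ≤ b → a • Γ + b • Γ' ∈ S :=
    fun Γ hΓ Γ' hΓ' a b ha hb t => ((hΓ t).smul ha).add ((hΓ' t).smul hb)
  have hLlin : ∀ (Γ Γ' : τ → Matrix ι ι ℂ) (a b : ℝ), L (a • Γ + b • Γ') = a • L Γ + b • L Γ' := by
    intro Γ Γ' a b
    simp only [L, Finset.smul_sum, ← Finset.sum_add_distrib]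
    refine Finset.sum_congr rfl fun t _ => ?_
    simp only [Pi.add_apply, Pi.smul_apply, Matrix.mul_add, Matrix.add_mul, Matrix.mul_smul,
      Matrix.smul_mul, smul_sub]
    abel
  by_contra hne
  have : LocallyConvexSpace ℝ (Matrix ι ι ℂ) :=
    inferInstanceAs (LocallyConvexSpace ℝ (ι → ι → ℂ))
  have hmem : T ∉ L '' S := fun ⟨Γ, hΓ, hΓT⟩ => hne ⟨Γ, hΓ, hΓT.symm⟩
  have hconv : Convex ℝ (L '' S) := by
    rintro _ ⟨Γ, hΓ, rfl⟩ _ ⟨Γ', hΓ', rfl⟩ a b ha hb -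
    exact ⟨a • Γ + b • Γ', hS Γ hΓ Γ' hΓ' a b ha hb, hLlin _ _ _ _⟩
  obtain ⟨F, u, hF, hFT⟩ := RCLike.geometric_hahn_banach_closed_point (𝕜 := ℂ) hconv hK hmem
  have h0 : 0 < u := by
    have := hF (L 0) ⟨0, fun t => .zero, rfl⟩
    simpa [L] using this
  -- A positive value could be rescaled within the cone to equal `u`, against the strict bound.
  have hneg : ∀ Γ ∈ S, (F (L Γ)).re ≤ 0 := by
    intro Γ hΓ
    by_contra! hpos
    have h1 := hF (L ((u / (F (L Γ)).re) • Γ + (0 : ℝ) • Γ))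
      ⟨_, hS Γ hΓ Γ hΓ _ 0 (by positivity) le_rfl, rfl⟩
    rw [hLlin, zero_smul, add_zero, map_real_smul F F.continuous] at h1
    simp [div_mul_cancel₀ _ hpos.ne'] at h1
  -- The matrix representing `F` through the trace pairing. Its negative, symmetrized, satisfies the
  -- Lyapunov inequalities but pairs negatively with `T`.
  let G : Matrix ι ι ℂ := Matrix.of fun b a => F (Matrix.single a b 1)
  have hG : ∀ M, (G * M).trace = F M := by
    intro M
    conv_rhs => rw [Matrix.matrix_eq_sum_single M]
    simp only [map_sum, Matrix.trace, Matrix.diag, Matrix.mul_apply]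
    rw [Finset.sum_comm]
    refine Finset.sum_congr rfl fun a _ => Finset.sum_congr rfl fun b _ => ?_
    have : Matrix.single a b (M a b) = M a b • Matrix.single a b 1 := by simp
    rw [this, map_smul, smul_eq_mul, mul_comm]
    rfl
  let H : Matrix ι ι ℂ := ((1 / 2 : ℝ) : ℂ) • (-G + (-G)ᴴ)
  have hHerm : H.IsHermitian := by
    simp only [H, Matrix.IsHermitian, Matrix.conjTranspose_smul, Matrix.conjTranspose_add,
      Matrix.conjTranspose_conjTranspose]
    rw [add_comm]
    simp
  have hHF : ∀ M : Matrix ι ι ℂ, M.IsHermitian → (H * M).trace.re = -(F M).re := fun M hM => by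
    rw [re_trace_symm _ _ hM, Matrix.neg_mul, Matrix.trace_neg, hG, Complex.neg_re]
  have := h H fun t => ?_
  · rw [hHF T hT] at this
    simp only [RCLike.re_to_complex] at hFT
    linarith
  · have hherm : (H - (X t)ᴴ * H * X t).IsHermitian :=
      hHerm.sub (Matrix.isHermitian_conjTranspose_mul_mul _ hHerm)
    refine .of_dotProduct_mulVec_nonneg hherm fun v => ?_
    rw [Complex.le_def]
    constructor
    · rw [← trace_mul_vecMulVec_star, ← trace_sub_conj, Complex.zero_re, hHF]
      · have h1 := hneg (Pi.single t (Matrix.vecMulVec v (star v))) (fun t' => by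
          by_cases ht : t' = t
          · subst ht; simpa using Matrix.posSemidef_vecMulVec_self_star v
          · rw [Pi.single_eq_of_ne ht]; exact .zero)
        have h2 : L (Pi.single t (Matrix.vecMulVec v (star v))) =
            Matrix.vecMulVec v (star v) - X t * Matrix.vecMulVec v (star v) * (X t)ᴴ := by
          simp only [L]
          rw [Finset.sum_eq_single t (fun t' _ ht => by simp [Pi.single_eq_of_ne ht]) (by simp)]
          simp
        rw [h2] at h1
        linarith
      · exact (Matrix.posSemidef_vecMulVec_self_star v).isHermitian.sub
          (Matrix.isHermitian_mul_mul_conjTranspose _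
            (Matrix.posSemidef_vecMulVec_self_star v).isHermitian)
    · have := hherm.im_star_dotProduct_mulVec_self v
      simpa using this.symm

end cone

/-! ### Strict solutions of simultaneous Lyapunov inequalities -/

section lyapunov

open scoped MatrixOrder ComplexOrder Matrix.Norms.L2Operator

variable {ι : Type*} [Fintype ι] [DecidableEq ι]

theorem eventually_le_one_of_tendsto_zero {E : ℕ → Matrix ι ι ℂ} (hE : ∀ n, IsSelfAdjoint (E n))
    (h : Filter.Tendsto E Filter.atTop (nhds 0)) : ∀ᶠ n in Filter.atTop, E n ≤ 1 := by
  have h1 : Filter.Tendsto (fun n => ‖E n‖) Filter.atTop (nhds 0) := by simpa using h.norm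
  filter_upwards [h1.eventually_lt_const one_pos] with n hn
  refine (hE n).le_algebraMap_norm_self.trans ?_
  rw [← map_one (algebraMap ℝ (Matrix ι ι ℂ))]
  exact algebraMap_mono _ hn.le

/-- Add one matrix at a time, replacing `G` by twice a long partial sum of `∑ₖ (X_j^k)* G X_j^k`.
The defect for `X_j` telescopes, while commutativity makes the defect of the sum for the earlier
`X_i` the sum of the old defects, hence still at least 1. -/
theorem exists_lyapunov {σ : Type*} [DecidableEq σ] (X : σ → Matrix ι ι ℂ)
    (hX : ∀ i j, Commute (X i) (X j))
    (hX0 : ∀ i, Filter.Tendsto (fun n => X i ^ n) Filter.atTop (nhds 0)) (S : Finset σ) :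
    ∃ G : Matrix ι ι ℂ, 1 ≤ G ∧ ∀ i ∈ S, 1 ≤ G - star (X i) * G * X i := by
  induction S using Finset.induction_on with
  | empty => exact ⟨1, le_rfl, by simp⟩
  | insert j S hj ih =>
    obtain ⟨G, hG, hS⟩ := ih
    have hG0 : 0 ≤ G := zero_le_one.trans hG
    have hGs : IsSelfAdjoint G := .of_nonneg hG0
    -- The tail of the telescoped defect is to be at most 1/2, so that doubling gives `2G - 1 ≥ 1`.
    -- The condition `1 ≤ n` keeps the term `k = 0`, whence `P ≤ shift P` for `P ≥ 0`.
    obtain ⟨n, hn1, hn⟩ : ∃ n, 1 ≤ n ∧ (2 : ℕ) • (star (X j ^ n) * G * X j ^ n) ≤ 1 := by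
      have h1 : Filter.Tendsto (fun n => (2 : ℕ) • (star (X j ^ n) * G * X j ^ n)) Filter.atTop
          (nhds 0) := by
        have := (((hX0 j).star.mul_const G).mul (hX0 j)).const_smul (2 : ℕ)
        simpa using this
      have h2 := eventually_le_one_of_tendsto_zero (fun n => ?_) h1
      · exact ((Filter.eventually_ge_atTop 1).and h2).exists
      · simp [IsSelfAdjoint, -nsmul_eq_mul, hGs.star_eq, mul_assoc]
    let shift : Matrix ι ι ℂ → Matrix ι ι ℂ := fun G => ∑ k ∈ Finset.range n,
      star (X j ^ k) * G * X j ^ k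
    have hmono : ∀ P Q, P ≤ Q → shift P ≤ shift Q := fun P Q h =>
      Finset.sum_le_sum fun k _ => star_left_conjugate_le_conjugate h _
    have hge : ∀ P, 0 ≤ P → P ≤ shift P := fun P hP => by
      have := Finset.single_le_sum (f := fun k => star (X j ^ k) * P * X j ^ k)
        (fun k _ => star_left_conjugate_nonneg hP _) (Finset.mem_range.mpr hn1)
      simpa [shift] using this
    have h1 : 1 ≤ shift G := hG.trans (hge G hG0)
    have h2 : ∀ i, shift G - star (X i) * shift G * X i = shift (G - star (X i) * G * X i) := by
      intro i
      simp only [shift, Finset.mul_sum, Finset.sum_mul, ← Finset.sum_sub_distrib]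
      refine Finset.sum_congr rfl fun k _ => ?_
      have hc : X i * X j ^ k = X j ^ k * X i := ((hX i j).pow_right k).eq
      have hc' : star (X i) * star (X j ^ k) = star (X j ^ k) * star (X i) := by
        rw [← star_mul, ← star_mul, hc]
      rw [mul_sub, sub_mul]
      congr 1
      calc _ = (star (X i) * star (X j ^ k)) * G * (X j ^ k * X i) := by simp only [mul_assoc]
        _ = _ := by rw [hc', ← hc]; simp only [mul_assoc]
    have h3 : shift G - star (X j) * shift G * X j = G - star (X j ^ n) * G * X j ^ n := by
      have := Finset.sum_range_sub' (fun k => star (X j ^ k) * G * X j ^ k) n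
      simp only [pow_zero, star_one, one_mul, mul_one] at this
      rw [← this]
      simp only [shift, Finset.mul_sum, Finset.sum_mul, ← Finset.sum_sub_distrib]
      refine Finset.sum_congr rfl fun k _ => ?_
      rw [pow_succ, star_mul]
      simp only [mul_assoc]
    have htwo : ∀ i, (2 : ℕ) • shift G - star (X i) * ((2 : ℕ) • shift G) * X i =
        (2 : ℕ) • (shift G - star (X i) * shift G * X i) := fun i => by
      rw [mul_smul_comm, smul_mul_assoc, smul_sub]
    have hdouble : ∀ P : Matrix ι ι ℂ, 1 ≤ P → 1 ≤ (2 : ℕ) • P := fun P hP => by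
      rw [two_nsmul]
      exact hP.trans (le_add_of_nonneg_left (zero_le_one.trans hP))
    refine ⟨(2 : ℕ) • shift G, hdouble _ h1, fun i hi => ?_⟩
    rw [htwo]
    rcases Finset.mem_insert.mp hi with rfl | hi
    · rw [h3, smul_sub]
      refine le_sub_iff_add_le.mpr ((add_le_add_right hn 1).trans ?_)
      rw [two_nsmul]
      exact add_le_add hG hG
    · rw [h2]
      exact hdouble _ ((hS i hi).trans (hge _ (zero_le_one.trans (hS i hi))))

end lyapunov

/-! ### Contractive matrices and the lurking contraction argument -/

section contraction

open scoped ComplexOrder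

variable {κ : Type*} [Fintype κ] [DecidableEq κ]

/-- The assignment `P v ↦ Q v` is well defined and contractive on the range of `P`; precompose it
with the orthogonal projection onto that range. -/
theorem exists_contraction_of_norm_le {V F : Type*} [AddCommGroup V] [Module ℂ V]
    [NormedAddCommGroup F] [InnerProductSpace ℂ F] [FiniteDimensional ℂ F]
    (P Q : V →ₗ[ℂ] F) (h : ∀ v, ‖Q v‖ ≤ ‖P v‖) :
    ∃ U : F →ₗ[ℂ] F, (∀ x, ‖U x‖ ≤ ‖x‖) ∧ ∀ v, U (P v) = Q v := by
  obtain ⟨s, hs⟩ := P.rangeRestrict.exists_rightInverse_of_surjective P.range_rangeRestrict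
  have hs' : ∀ y : LinearMap.range P, P (s y) = y := fun y =>
    congrArg Subtype.val (LinearMap.congr_fun hs y)
  have hQ : ∀ v v', P v = P v' → Q v = Q v' := fun v v' hv => by
    have := h (v - v')
    rw [map_sub, map_sub, hv, sub_self, norm_zero, norm_le_zero_iff, sub_eq_zero] at this
    exact this
  refine ⟨Q ∘ₗ s ∘ₗ (LinearMap.range P).orthogonalProjectionOnto.toLinearMap, fun x => ?_, fun v => ?_⟩
  · calc _ ≤ ‖P (s ((LinearMap.range P).orthogonalProjectionOnto x))‖ := h _
      _ = ‖(LinearMap.range P).orthogonalProjectionOnto x‖ := by rw [hs']; rfl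
      _ ≤ ‖x‖ := (LinearMap.range P).norm_orthogonalProjectionOnto_apply_le x
  · refine hQ _ _ ?_
    refine (hs' _).trans ?_
    exact (LinearMap.range P).starProjection_eq_self_iff.mpr ⟨v, rfl⟩

/-- With `1 - U* U = B* B`, the right side minus the left side is `∑ₛ ‖∑ₜ B s t • x t‖²`. The
vectors may lie in any inner product space, in particular in `H_k`. -/
theorem sum_norm_sq_le_of_contraction {U : Matrix κ κ ℂ} (hU : (1 - Uᴴ * U).PosSemidef)
    {H : Type*} [NormedAddCommGroup H] [InnerProductSpace ℂ H] (x : κ → H) :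
    ∑ s, ‖∑ t, U s t • x t‖ ^ 2 ≤ ∑ t, ‖x t‖ ^ 2 := by
  obtain ⟨B, hB⟩ := hU.exists_eq_conjTranspose_mul_self
  have key : ∀ V : Matrix κ κ ℂ, ((∑ s, ‖∑ t, V s t • x t‖ ^ 2 : ℝ) : ℂ) =
      ∑ t, ∑ t', (Vᴴ * V) t t' * inner ℂ (x t) (x t') := by
    intro V
    push_cast
    have : ∀ s, ((‖∑ t, V s t • x t‖ : ℂ)) ^ 2 =
        ∑ t, ∑ t', star (V s t) * V s t' * inner ℂ (x t) (x t') := fun s => by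
      refine (inner_self_eq_norm_sq_to_K (𝕜 := ℂ) (∑ t, V s t • x t)).symm.trans ?_
      rw [sum_inner]
      refine Finset.sum_congr rfl fun t _ => ?_
      rw [inner_sum]
      refine Finset.sum_congr rfl fun t' _ => ?_
      rw [inner_smul_left, inner_smul_right]
      simp [mul_assoc]
    simp only [this, Matrix.mul_apply, Finset.sum_mul, Matrix.conjTranspose_apply]
    rw [Finset.sum_comm]
    exact Finset.sum_congr rfl fun t _ => Finset.sum_comm
  have h1 := key 1
  have h2 := key U
  have h3 := key B
  rw [← hB] at h3
  simp only [Matrix.sub_apply, sub_mul, Finset.sum_sub_distrib] at h3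
  simp only [Matrix.conjTranspose_one, Matrix.mul_one] at h1
  rw [← h1, ← h2, ← Complex.ofReal_sub, Complex.ofReal_inj] at h3
  have h4 : ∀ s, ∑ t, (1 : Matrix κ κ ℂ) s t • x t = x s := fun s => by simp [Matrix.one_apply]
  simp only [h4] at h3
  have h5 : 0 ≤ ∑ s, ‖∑ t, B s t • x t‖ ^ 2 := Finset.sum_nonneg fun s _ => by positivity
  linarith

theorem posSemidef_one_sub_conj {U : Matrix κ κ ℂ} (hU : (1 - Uᴴ * U).PosSemidef) :
    (1 - (U.map conj)ᴴ * U.map conj).PosSemidef := by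
  have h : (U.map conj)ᴴ * U.map conj = (Uᴴ * U)ᵀ := by
    rw [Matrix.transpose_mul]
    congr 1
    ext
    simp
  have := hU.transpose
  rwa [Matrix.transpose_sub, Matrix.transpose_one, ← h] at this

theorem exists_contraction_matrix {V : Type*} [AddCommGroup V] [Module ℂ V]
    (P Q : V →ₗ[ℂ] κ → ℂ) (h : ∀ v, ∑ s, ‖Q v s‖ ^ 2 ≤ ∑ s, ‖P v s‖ ^ 2) :
    ∃ U : Matrix κ κ ℂ, (1 - Uᴴ * U).PosSemidef ∧ ∀ v, U *ᵥ P v = Q v := by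
  let e := (WithLp.linearEquiv 2 ℂ (κ → ℂ)).symm
  have he : ∀ x : κ → ℂ, ‖e x‖ ^ 2 = ∑ s, ‖x s‖ ^ 2 := fun x => by
    simp [e, EuclideanSpace.norm_sq_eq]
  obtain ⟨T, hT, hTPQ⟩ := exists_contraction_of_norm_le (e.toLinearMap ∘ₗ P) (e.toLinearMap ∘ₗ Q)
    fun v => by
      refine le_of_sq_le_sq ?_ (norm_nonneg _)
      simpa [he] using h v
  let U : Matrix κ κ ℂ := LinearMap.toMatrix' (e.symm.toLinearMap ∘ₗ T ∘ₗ e.toLinearMap)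
  have hU : ∀ x, U *ᵥ x = e.symm (T (e x)) := fun x => by
    rw [← Matrix.toLin'_apply, Matrix.toLin'_toMatrix']; rfl
  refine ⟨U, ?_, fun v => ?_⟩
  · refine .of_dotProduct_mulVec_nonneg ?_ fun x => ?_
    · exact Matrix.isHermitian_one.sub (Matrix.isHermitian_conjTranspose_mul_self U)
    · have h1 : ∀ y : κ → ℂ, star y ⬝ᵥ y = ((‖e y‖ ^ 2 : ℝ) : ℂ) := fun y => by
        rw [he, dotProduct]
        push_cast
        refine Finset.sum_congr rfl fun s _ => ?_
        rw [Pi.star_apply, RCLike.star_def, Complex.conj_mul']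
      rw [Matrix.sub_mulVec, Matrix.one_mulVec, dotProduct_sub, ← Matrix.mulVec_mulVec,
        Matrix.dotProduct_mulVec, ← Matrix.star_mulVec, h1, h1, ← Complex.ofReal_sub]
      rw [Complex.zero_le_real, hU, e.apply_symm_apply]
      have := hT (e x)
      have := norm_nonneg (T (e x))
      nlinarith
  · rw [hU]
    exact (LinearEquiv.symm_apply_eq _).mpr (hTPQ v)

theorem star_dotProduct_conjTranspose_mul_self_mulVec {ι l : Type*} [Fintype ι] [Fintype l]
    (B : Matrix l ι ℂ) (v : ι → ℂ) :
    star v ⬝ᵥ ((Bᴴ * B) *ᵥ v) = ((∑ s, ‖(B *ᵥ v) s‖ ^ 2 : ℝ) : ℂ) := by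
  rw [← Matrix.mulVec_mulVec, Matrix.dotProduct_mulVec, ← Matrix.star_mulVec, dotProduct]
  push_cast
  refine Finset.sum_congr rfl fun s _ => ?_
  rw [Pi.star_apply, RCLike.star_def, Complex.conj_mul']

/-- A positivity certificate `C² e e* - β β* ≥ ∑ᵢ (Γᵢ - Xᵢ Γᵢ Xᵢ*)` yields a contractive
state-space realization. -/
theorem exists_realization {ι : Type*} [Fintype ι] [DecidableEq ι] {d : ℕ}
    (X Γ : Fin d → Matrix ι ι ℂ) (e β : ι → ℂ) (C : ℝ)
    (hΓ : ∀ i, (Γ i).PosSemidef)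
    (h : (((C ^ 2 : ℝ) : ℂ) • Matrix.vecMulVec e (star e) - Matrix.vecMulVec β (star β) -
      ∑ i, (Γ i - X i * Γ i * (X i)ᴴ)).PosSemidef) :
    ∃ (U : Matrix (Option (Fin d × ι)) (Option (Fin d × ι)) ℂ) (g : Fin d × ι → ι → ℂ),
      (1 - Uᴴ * U).PosSemidef ∧
      β = (C * U none none) • e + ∑ t, U none (some t) • (X t.1 *ᵥ g t) ∧
      ∀ s, g s = (C * U (some s) none) • e + ∑ t, U (some s) (some t) • (X t.1 *ᵥ g t) := by
  choose B hB using fun i => (hΓ i).exists_eq_conjTranspose_mul_self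
  -- The vectors `g (i, l)` are the columns of `(B i)*`, so that `Γ i = ∑ₗ g gᴴ`.
  let g : Fin d × ι → ι → ℂ := fun t => star (B t.1 t.2)
  let P : (ι → ℂ) →ₗ[ℂ] Option (Fin d × ι) → ℂ :=
    { toFun := fun v s => v ⬝ᵥ (s.elim ((C : ℂ) • e) fun t => X t.1 *ᵥ g t)
      map_add' := fun v w => by ext; simp [add_dotProduct]
      map_smul' := fun c v => by ext; simp [smul_dotProduct] }
  let Q : (ι → ℂ) →ₗ[ℂ] Option (Fin d × ι) → ℂ :=
    { toFun := fun v s => v ⬝ᵥ (s.elim β g)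
      map_add' := fun v w => by ext; simp [add_dotProduct]
      map_smul' := fun c v => by ext; simp [smul_dotProduct] }
  have hsq : ∀ w v : ι → ℂ, v ⬝ᵥ (Matrix.vecMulVec w (star w) *ᵥ star v) =
      ((‖v ⬝ᵥ w‖ ^ 2 : ℝ) : ℂ) := by
    intro w v
    rw [Matrix.vecMulVec_mulVec, op_smul_eq_smul, dotProduct_smul, smul_eq_mul,
      Complex.ofReal_pow, ← Complex.conj_mul']
    congr 1
    simp [dotProduct, mul_comm]
  have hg : ∀ i l (v : ι → ℂ), (B i *ᵥ star v) l = star (v ⬝ᵥ g (i, l)) := by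
    intro i l v
    simp [Matrix.mulVec, dotProduct, g, mul_comm]
  -- The certificate evaluated at `star v`, with the negative terms moved across: `|v·β|² + ∑ |v·g|²
  -- ≤ |v·Ce|² + ∑ |v·Xg|²`.
  have hPQ : ∀ v, ∑ s, ‖Q v s‖ ^ 2 ≤ ∑ s, ‖P v s‖ ^ 2 := by
    intro v
    have h1 := h.dotProduct_mulVec_nonneg (star v)
    have h2 : ∀ i, v ⬝ᵥ ((Γ i) *ᵥ star v) = ((∑ l, ‖v ⬝ᵥ g (i, l)‖ ^ 2 : ℝ) : ℂ) := by
      intro i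
      have := star_dotProduct_conjTranspose_mul_self_mulVec (B i) (star v)
      simpa only [star_star, ← hB, hg, norm_star] using this
    have h3 : ∀ i, v ⬝ᵥ ((X i * Γ i * (X i)ᴴ) *ᵥ star v) =
        ((∑ l, ‖v ⬝ᵥ (X i *ᵥ g (i, l))‖ ^ 2 : ℝ) : ℂ) := by
      intro i
      have h4 : X i * Γ i * (X i)ᴴ = (B i * (X i)ᴴ)ᴴ * (B i * (X i)ᴴ) := by
        rw [hB i, Matrix.conjTranspose_mul, Matrix.conjTranspose_conjTranspose]
        simp only [Matrix.mul_assoc]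
      have h5 : ∀ l, ((B i * (X i)ᴴ) *ᵥ star v) l = star (v ⬝ᵥ (X i *ᵥ g (i, l))) := fun l => by
        rw [← Matrix.mulVec_mulVec, ← Matrix.star_vecMul, hg, Matrix.dotProduct_mulVec]
      have := star_dotProduct_conjTranspose_mul_self_mulVec (B i * (X i)ᴴ) (star v)
      simpa only [star_star, ← h4, h5, norm_star] using this
    simp only [Matrix.sub_mulVec, Matrix.smul_mulVec, dotProduct_sub, dotProduct_smul,
      Matrix.sum_mulVec, dotProduct_sum, star_star, smul_eq_mul] at h1
    simp only [hsq, h2, h3] at h1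
    simp only [← Complex.ofReal_sub, ← Complex.ofReal_mul, ← Complex.ofReal_sum,
      Complex.zero_le_real] at h1
    simp only [Fintype.sum_option, P, Q, LinearMap.coe_mk, AddHom.coe_mk, Option.elim_none,
      Option.elim_some, dotProduct_smul, Fintype.sum_prod_type, norm_smul, mul_pow,
      Complex.norm_real, sq_abs, Real.norm_eq_abs, Finset.sum_sub_distrib] at h1 ⊢
    linarith
  obtain ⟨U, hU, hUPQ⟩ := exists_contraction_matrix P Q hPQ
  -- Pairing with unit vectors turns `U ∘ P = Q` into vector equations, entry by entry.
  have key : ∀ s a, Q (Pi.single a 1) s = ∑ t, U s t * P (Pi.single a 1) t := fun s a =>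
    (congrFun (hUPQ (Pi.single a 1)) s).symm
  simp only [P, Q, LinearMap.coe_mk, AddHom.coe_mk, single_one_dotProduct,
    Fintype.sum_option, Option.elim_none, Option.elim_some] at key
  refine ⟨U, g, hU, ?_, fun s => ?_⟩
  · ext a
    rw [show β a = _ from key none a]
    simp only [Pi.add_apply, Finset.sum_apply, Pi.smul_apply, smul_eq_mul]
    ring
  · ext a
    rw [show g s a = _ from key (some s) a]
    simp only [Pi.add_apply, Finset.sum_apply, Pi.smul_apply, smul_eq_mul]
    ring

end contraction

/-! ### Construction of admissible kernels -/

theorem extendZero_eqOn {d : ℕ} {f : polydisc d → ℂ} {g : (Fin d → ℂ) → ℂ}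
    (h : ∀ z : polydisc d, f z = g z.1) : Set.EqOn (extendZero f) g (polydisc d) := by
  intro z hz
  rw [extendZero_apply f ⟨z, hz⟩, h]

/-- A Hilbert space with continuous evaluations at the points of the polydisc yields, after
removing the common kernel of the evaluations, an admissible kernel. -/
theorem exists_admissibleKernel_of_model {d : ℕ} {E : Type} [NormedAddCommGroup E]
    [InnerProductSpace ℂ E] [CompleteSpace E] (ev : polydisc d → E →L[ℂ] ℂ)
    (hol : ∀ a, DifferentiableOn ℂ (extendZero fun z => ev z a) (polydisc d))
    (hmul : ∀ (i : Fin d) (a : E), ∃ b, (∀ z, ev z b = z.1 i * ev z a) ∧ ‖b‖ ≤ ‖a‖) :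
    ∃ k : AdmissibleKernel d,
      (∀ f : k.H, ∃ a : E, ‖a‖ = ‖f‖ ∧ ∀ z, f z = ev z a) ∧
      ∀ a : E, ∃ f : k.H, ‖f‖ ≤ ‖a‖ ∧ ∀ z, f z = ev z a := by
  -- Evaluation is injective on `Nᗮ`, and projecting to `Nᗮ` changes no value and increases no norm.
  let N : Submodule ℂ E := ⨅ z, LinearMap.ker (ev z).toLinearMap
  have hN : ∀ a ∈ N, ∀ z, ev z a = 0 := fun a ha z => (Submodule.mem_iInf _).mp ha z
  have hNc : IsClosed (N : Set E) := by
    have : (N : Set E) = ⋂ z, {a | ev z a = 0} := by ext; simp [N]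
    rw [this]
    exact isClosed_iInter fun z => isClosed_eq (ev z).continuous continuous_const
  have : CompleteSpace N := hNc.completeSpace_coe
  let r : RKHS ℂ Nᗮ (polydisc d) ℂ :=
    { coeCLM := ContinuousLinearMap.pi fun z => (ev z).comp Nᗮ.subtypeL
      coeCLM_injective := by
        rw [injective_iff_map_eq_zero]
        intro a ha
        have h1 : a.1 ∈ N := (Submodule.mem_iInf _).mpr fun z => congrFun ha z
        exact Subtype.ext (inner_self_eq_zero.mp (a.2 a.1 h1)) }
  have hr : ∀ (a : Nᗮ) (z : polydisc d), a z = ev z a.1 := fun a z => rfl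
  have hlift : ∀ a : E, ∃ f : Nᗮ, ‖f‖ ≤ ‖a‖ ∧ ∀ z, f z = ev z a := by
    intro a
    refine ⟨Nᗮ.orthogonalProjectionOnto a, Nᗮ.norm_orthogonalProjectionOnto_apply_le a,
      fun z => ?_⟩
    rw [hr, eq_comm, ← sub_eq_zero, ← map_sub]
    refine hN _ ?_ z
    have := Nᗮ.sub_starProjection_mem_orthogonal a
    rwa [Submodule.orthogonal_orthogonal] at this
  refine ⟨{ H := Nᗮ, rkhs := r, holomorphic := fun f => hol f.1, contraction := fun i f => ?_ },
    fun f => ⟨f.1, rfl, fun z => rfl⟩, hlift⟩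
  obtain ⟨b, hb, hbn⟩ := hmul i f.1
  obtain ⟨g, hg, hgb⟩ := hlift b
  exact ⟨g, fun z => (hgb z).trans (hb z), hg.trans hbn⟩

section shift

/-- Meant for `x` a shift `S_i` and `h j = (1 - z_j S_j*)⁻¹`: the first term on the right begins
with `S_i` and is killed by the vacuum functional, leaving multiplication by `c = z_i`. -/
theorem prod_ofFn_mul {α : Type*} [Ring α] [Algebra ℂ α] {d : ℕ} (h : Fin d → α) (x : α) (c : ℂ)
    (i : Fin d) (hx : ∀ j ≠ i, Commute x (h j)) (hi : h i * x = x + c • h i) :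
    (List.ofFn h).prod * x =
      x * (List.ofFn (Function.update h i 1)).prod + c • (List.ofFn h).prod := by
  induction d with
  | zero => exact i.elim0
  | succ d ih =>
    rw [List.ofFn_succ, List.ofFn_succ, List.prod_cons, List.prod_cons]
    obtain rfl | ⟨i, rfl⟩ := Fin.eq_zero_or_eq_succ i
    · have h1 : Commute x (List.ofFn fun j => h (Fin.succ j)).prod := by
        refine Commute.list_prod_right _ _ fun y hy => ?_
        obtain ⟨j, rfl⟩ := (List.mem_ofFn' _ _).mp hy
        exact hx _ (Fin.succ_ne_zero j)
      simp only [Function.update_self, one_mul, ne_eq, Fin.succ_ne_zero, not_false_eq_true,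
        Function.update_of_ne]
      rw [mul_assoc, ← h1.eq, ← mul_assoc, hi, add_mul, smul_mul_assoc]
    · have h1 : (fun j : Fin d => Function.update h i.succ 1 j.succ) =
          Function.update (fun j : Fin d => h j.succ) i 1 := by
        ext j
        by_cases hj : j = i
        · subst hj; simp
        · simp [Function.update_of_ne, hj]
      rw [h1, mul_assoc, ih (fun j => h j.succ) i (fun j hj => hx _ (by simpa using hj)) hi,
        Function.update_of_ne (Fin.succ_ne_zero i).symm, mul_add, ← mul_assoc,
        ← (hx 0 (Fin.succ_ne_zero i).symm).eq, mul_assoc, mul_smul_comm]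

theorem DifferentiableOn.list_prod_ofFn {α E : Type*} [NormedAddCommGroup E] [NormedSpace ℂ E]
    [NormedRing α] [NormedAlgebra ℂ α] {d : ℕ} {h : Fin d → E → α} {s : Set E}
    (hh : ∀ i, DifferentiableOn ℂ (h i) s) :
    DifferentiableOn ℂ (fun z => (List.ofFn fun i => h i z).prod) s := by
  induction d with
  | zero => simp
  | succ d ih =>
    simp only [List.ofFn_succ, List.prod_cons]
    exact (hh 0).fun_mul (ih fun i => hh i.succ)

variable {d : ℕ} {E : Type*} [NormedAddCommGroup E] [InnerProductSpace ℂ E] [CompleteSpace E]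

/-- A Hilbert basis indexed by multi-indices carries doubly commuting shifts. -/
theorem HilbertBasis.exists_shift (b : HilbertBasis (Fin d → ℕ) ℂ E) :
    ∃ S : Fin d → E →L[ℂ] E, (∀ i, ‖S i‖ ≤ 1) ∧ (∀ i, star (S i) * S i = 1) ∧
      (∀ i j, i ≠ j → Commute (S i) (star (S j))) ∧ ∀ i, star (S i) (b 0) = 0 := by
  have hinj : ∀ i : Fin d, Function.Injective fun α : Fin d → ℕ => α + Pi.single i 1 :=
    fun i => add_left_injective _
  let T : ∀ i, E →ₗᵢ[ℂ] E := fun i =>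
    ((b.orthonormal.comp _ (hinj i)).orthogonalFamily.linearIsometry).comp b.repr.toLinearIsometry
  have hT : ∀ i α, T i (b α) = b (α + Pi.single i 1) := by
    intro i α
    simp only [T, LinearIsometry.coe_comp, Function.comp_apply,
      LinearIsometryEquiv.coe_toLinearIsometry, b.repr_self]
    rw [OrthogonalFamily.linearIsometry_apply_single]
    simp
  let S : Fin d → E →L[ℂ] E := fun i => (T i).toContinuousLinearMap
  have hS : ∀ i α, S i (b α) = b (α + Pi.single i 1) := hT
  have hext : ∀ x y : E, (∀ α, inner ℂ (b α) x = inner ℂ (b α) y) → x = y := by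
    intro x y h
    refine b.repr.injective (lp.ext (funext fun α => ?_))
    rw [b.repr_apply_apply, b.repr_apply_apply, h]
  have hext' : ∀ P Q : E →L[ℂ] E, (∀ α, P (b α) = Q (b α)) → P = Q := by
    intro P Q h
    refine ContinuousLinearMap.ext_on (s := Set.range b) ?_ ?_
    · exact Submodule.dense_iff_topologicalClosure_eq_top.mpr b.dense_span
    · rintro _ ⟨α, rfl⟩; exact h α
  have hb : ∀ α β, inner ℂ (b α) (b β) = if α = β then (1 : ℂ) else 0 :=
    orthonormal_iff_ite.mp b.orthonormal
  have hstar : ∀ i x y, inner ℂ x (star (S i) y) = inner ℂ (S i x) y := fun i x y =>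
    (S i).adjoint_inner_right x y
  have hL1 : ∀ i α, star (S i) (b (α + Pi.single i 1)) = b α := by
    intro i α
    refine hext _ _ fun γ => ?_
    rw [hstar, hS, hb, hb]
    simp
  have hL0 : ∀ i (α : Fin d → ℕ), α i = 0 → star (S i) (b α) = 0 := by
    intro i α hα
    refine hext _ _ fun γ => ?_
    rw [hstar, hS, hb, inner_zero_right, if_neg]
    intro h
    have := congrFun h i
    simp [hα] at this
  refine ⟨S, fun i => (T i).norm_toContinuousLinearMap_le, fun i => hext' _ _ fun α => ?_,
    fun i j hij => hext' _ _ fun α => ?_, fun i => hL0 i 0 rfl⟩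
  · change star (S i) (S i (b α)) = b α
    rw [hS, hL1]
  · change S i (star (S j) (b α)) = star (S j) (S i (b α))
    rw [hS]
    by_cases hα : α j = 0
    · rw [hL0 j α hα, map_zero, hL0 j _ (by simp [hα, hij.symm])]
    · obtain ⟨γ, rfl⟩ : ∃ γ, α = γ + Pi.single j 1 := ⟨α - Pi.single j 1, by
        ext l
        by_cases hl : l = j
        · subst hl; simp; omega
        · simp [hl]⟩
      rw [hL1, hS, add_right_comm, hL1]

end shift

/-- The Hardy space of the polydisc: an admissible kernel whose space contains the constants. -/
theorem exists_admissibleKernel_one (d : ℕ) :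
    ∃ (k : AdmissibleKernel d) (f : k.H), ∀ z, f z = 1 := by
  let E := lp (fun _ : Fin d → ℕ => ℂ) 2
  let b : HilbertBasis (Fin d → ℕ) ℂ E := .ofRepr (LinearIsometryEquiv.refl ℂ E)
  obtain ⟨S, hS, hSS, hcomm, hS0⟩ := b.exists_shift
  let h : Fin d → (Fin d → ℂ) → E →L[ℂ] E := fun i z => Ring.inverse (1 - z i • star (S i))
  have hunit : ∀ i, ∀ z ∈ polydisc d, IsUnit (1 - z i • star (S i)) := by
    intro i z hz
    refine isUnit_one_sub_of_norm_lt_one ?_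
    rw [norm_smul, norm_star]
    exact (mul_le_of_le_one_right (norm_nonneg _) (hS i)).trans_lt (hz i)
  let P : (Fin d → ℂ) → E →L[ℂ] E := fun z => (List.ofFn fun i => h i z).prod
  have hP : DifferentiableOn ℂ P (polydisc d) := by
    refine DifferentiableOn.list_prod_ofFn fun i z hz => ?_
    refine DifferentiableAt.differentiableWithinAt ?_
    exact (differentiableAt_inverse (hunit i z hz)).comp z (f := fun z : Fin d → ℂ =>
      1 - z i • star (S i)) (by fun_prop)
  -- Expanding `∏ⱼ (1 - z_j S_j*)⁻¹` into Neumann series, this is the sum of the power series with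
  -- coefficients `a`; in this form no summation over multi-indices is needed.
  let ev : polydisc d → E →L[ℂ] ℂ := fun z => (innerSL ℂ (b 0)).comp (P z.1)
  have hmul : ∀ (i : Fin d) (z : polydisc d) a, ev z (S i a) = z.1 i * ev z a := by
    intro i z a
    have h1 := prod_ofFn_mul (fun j => h j z.1) (S i) (z.1 i) i (fun j hj => ?_) ?_
    · have h2 := congrArg (fun Q : E →L[ℂ] E => inner ℂ (b 0) (Q a)) h1
      have h3 : ∀ x, inner ℂ (b 0) (S i x) = 0 := fun x => by
        rw [← ContinuousLinearMap.adjoint_inner_left, ← ContinuousLinearMap.star_eq_adjoint, hS0,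
          inner_zero_left]
      change inner ℂ (b 0) (P z.1 (S i a)) = z.1 i * inner ℂ (b 0) (P z.1 a)
      simpa [h3, inner_smul_right] using h2
    · have h1 : Commute (S i) (1 - z.1 j • star (S j)) :=
        (Commute.one_right _).sub_right ((hcomm i j hj.symm).smul_right _)
      obtain ⟨u, hu⟩ := hunit j z.1 z.2
      simp only [h]
      rw [← hu, Ring.inverse_unit]
      rw [← hu] at h1
      exact h1.units_inv_right
    · have hu := hunit i z.1 z.2
      -- Uses `S_i* S_i = 1`; equivalently `h_i S_i = S_i + z_i h_i`.
      have h1 : S i = (1 - z.1 i • star (S i)) * (S i + z.1 i • h i z.1) := by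
        have h2 : (1 - z.1 i • star (S i)) * h i z.1 = 1 := Ring.mul_inverse_cancel _ hu
        rw [mul_add, mul_smul_comm, h2, sub_mul, one_mul, smul_mul_assoc, hSS]
        abel
      calc h i z.1 * S i = h i z.1 * ((1 - z.1 i • star (S i)) * (S i + z.1 i • h i z.1)) := by
            rw [← h1]
        _ = _ := by rw [← mul_assoc, Ring.inverse_mul_cancel _ hu, one_mul]
  have hone : ∀ z, ev z (b 0) = 1 := by
    intro z
    have h1 : ∀ i, h i z.1 (b 0) = b 0 := fun i => by
      have h2 : h i z.1 * (1 - z.1 i • star (S i)) = 1 :=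
        Ring.inverse_mul_cancel _ (hunit i z.1 z.2)
      have h3 := congrArg (fun Q : E →L[ℂ] E => Q (b 0)) h2
      simpa [hS0] using h3
    have h2 : ∀ l : List (E →L[ℂ] E), (∀ Q ∈ l, Q (b 0) = b 0) → l.prod (b 0) = b 0 := by
      intro l
      induction l with
      | nil => intro _; rfl
      | cons Q l ih =>
        intro hl
        rw [List.prod_cons]
        change Q (l.prod (b 0)) = b 0
        rw [ih fun Q hQ => hl Q (List.mem_cons_of_mem _ hQ), hl Q List.mem_cons_self]
    have h3 : P z.1 (b 0) = b 0 := h2 _ fun Q hQ => by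
      obtain ⟨i, rfl⟩ := (List.mem_ofFn' _ _).mp hQ
      exact h1 i
    change inner ℂ (b 0) (P z.1 (b 0)) = 1
    rw [h3, inner_self_eq_norm_sq_to_K, b.orthonormal.1 0]
    simp
  have hol : ∀ a, DifferentiableOn ℂ (extendZero fun z => ev z a) (polydisc d) := fun a => by
    have h1 : DifferentiableOn ℂ (fun z => inner ℂ (b 0) (P z a)) (polydisc d) :=
      (innerSL ℂ (b 0)).differentiable.comp_differentiableOn
        (hP.clm_apply (differentiableOn_const a))
    exact h1.congr (extendZero_eqOn fun z => rfl)
  obtain ⟨k, -, hk⟩ := exists_admissibleKernel_of_model ev hol fun i a =>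
    ⟨S i a, fun z => hmul i z a, (S i).le_of_opNorm_le (hS i) a |>.trans (one_mul _).le⟩
  obtain ⟨f, -, hf⟩ := hk (b 0)
  exact ⟨k, f, fun z => (hf z).trans (hone z)⟩

/-- The renorming `‖a‖² + ‖Λ a‖²` is the norm of the graph of `Λ`, which is closed, hence a Hilbert
space. Multiplication by a coordinate contracts both summands. -/
theorem exists_graph_kernel {d : ℕ} (k₀ : AdmissibleKernel d) {F : Type} [NormedAddCommGroup F]
    [InnerProductSpace ℂ F] [CompleteSpace F] (Λ : k₀.H →L[ℂ] F)
    (hΛ : ∀ (i : Fin d) (f g : k₀.H), (∀ z, g z = z.1 i * f z) → ‖Λ g‖ ≤ ‖Λ f‖) :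
    ∃ k : AdmissibleKernel d,
      (∀ f : k.H, ∃ a : k₀.H, ‖a‖ ^ 2 + ‖Λ a‖ ^ 2 = ‖f‖ ^ 2 ∧ ∀ z, f z = a z) ∧
      ∀ a : k₀.H, ∃ f : k.H, ‖f‖ ^ 2 ≤ ‖a‖ ^ 2 + ‖Λ a‖ ^ 2 ∧ ∀ z, f z = a z := by
  let T : WithLp 2 (k₀.H × F) →L[ℂ] F :=
    WithLp.sndL 2 ℂ k₀.H F - Λ.comp (WithLp.fstL 2 ℂ k₀.H F)
  let G : Submodule ℂ (WithLp 2 (k₀.H × F)) := LinearMap.ker T.toLinearMap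
  have hG : ∀ x ∈ G, x.snd = Λ x.fst := fun x hx => sub_eq_zero.mp hx
  have hnorm : ∀ x : G, ‖x.1.fst‖ ^ 2 + ‖Λ x.1.fst‖ ^ 2 = ‖x‖ ^ 2 := fun x => by
    rw [← hG x.1 x.2, ← WithLp.prod_norm_sq_eq_of_L2]; rfl
  let lift : k₀.H → G := fun a => ⟨WithLp.toLp 2 (a, Λ a), sub_self _⟩
  have : CompleteSpace G :=
    (isClosed_eq T.continuous continuous_const : IsClosed {x | T x = 0}).completeSpace_coe
  let ev : polydisc d → G →L[ℂ] ℂ := fun z =>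
    ((ContinuousLinearMap.proj (R := ℂ) (φ := fun _ : polydisc d => ℂ) z).comp
      (RKHS.coeCLM ℂ)).comp ((WithLp.fstL 2 ℂ k₀.H F).comp G.subtypeL)
  obtain ⟨k, hk1, hk2⟩ := exists_admissibleKernel_of_model ev (fun x => k₀.holomorphic x.1.fst)
    fun i x => by
      obtain ⟨g, hg, hgn⟩ := k₀.contraction i x.1.fst
      refine ⟨lift g, hg, le_of_sq_le_sq ?_ (norm_nonneg _)⟩
      rw [← hnorm, ← hnorm]
      exact add_le_add (pow_le_pow_left₀ (norm_nonneg _) hgn 2)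
        (pow_le_pow_left₀ (norm_nonneg _) (hΛ i _ _ hg) 2)
  refine ⟨k, fun f => ?_, fun a => ?_⟩
  · obtain ⟨x, hx, hfx⟩ := hk1 f
    exact ⟨x.1.fst, by rw [hnorm, hx], hfx⟩
  · obtain ⟨f, hf, hfa⟩ := hk2 (lift a)
    refine ⟨f, ?_, hfa⟩
    have := hnorm (lift a)
    rw [show (lift a).1.fst = a from rfl] at this
    rw [this]
    exact pow_le_pow_left₀ (norm_nonneg _) hf 2

/-- Extension by Hahn–Banach followed by Riesz representation, so `p` may be a non-closed span. -/
theorem exists_inner_eq_of_subspace {E : Type*} [NormedAddCommGroup E] [InnerProductSpace ℂ E]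
    [CompleteSpace E] (p : Submodule ℂ E) (T : p →L[ℂ] ℂ) :
    ∃ g : E, ‖g‖ = ‖T‖ ∧ ∀ x : p, inner ℂ g x.1 = T x := by
  obtain ⟨T', hT', hn⟩ := exists_extension_norm_eq p T
  refine ⟨(InnerProductSpace.toDual ℂ E).symm T', by simp [hn], fun x => ?_⟩
  rw [InnerProductSpace.toDual_symm_apply, hT']

/-! ### Joint matrix values, and the inequality forced by the bound on `R^k` -/

section evaluation

variable {d N : ℕ} {s : Fin N → ℕ} (A : ∀ j, Fin d → Matrix (Fin (s j)) (Fin (s j)) ℂ)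

/-- The entries of a family of square matrices as a single vector. -/
def entries (B : ∀ j, Matrix (Fin (s j)) (Fin (s j)) ℂ) :
    (Σ j, Fin (s j) × Fin (s j)) → ℂ := fun x => B x.1 x.2.1 x.2.2

theorem entries_injective : Function.Injective (entries (s := s)) := fun B B' h => by
  ext j a b
  exact congrFun h ⟨j, a, b⟩

/-- The matrix of the simultaneous left multiplication by the `i`-th members of the tuples. -/
def leftMulMatrix (i : Fin d) :
    Matrix (Σ j, Fin (s j) × Fin (s j)) (Σ j, Fin (s j) × Fin (s j)) ℂ :=
  LinearMap.toMatrix'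
    { toFun := fun p x => ∑ c, A x.1 i x.2.1 c * p ⟨x.1, c, x.2.2⟩
      map_add' := fun p q => by ext; simp [mul_add, Finset.sum_add_distrib]
      map_smul' := fun r p => by ext; simp [Finset.mul_sum, mul_left_comm] }

theorem leftMulMatrix_mulVec (i : Fin d) (B : ∀ j, Matrix (Fin (s j)) (Fin (s j)) ℂ) :
    leftMulMatrix A i *ᵥ entries B = entries fun j => A j i * B j := by
  rw [leftMulMatrix, LinearMap.toMatrix'_mulVec]
  ext x
  simp [entries, Matrix.mul_apply]

theorem entries_surjective : Function.Surjective (entries (s := s)) := fun p =>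
  ⟨fun j => Matrix.of fun a b => p ⟨j, a, b⟩, rfl⟩

theorem leftMulMatrix_pow_mulVec (i : Fin d) (B : ∀ j, Matrix (Fin (s j)) (Fin (s j)) ℂ) (n : ℕ) :
    leftMulMatrix A i ^ n *ᵥ entries B = entries fun j => A j i ^ n * B j := by
  induction n with
  | zero => simp
  | succ n ih =>
    rw [pow_succ', ← Matrix.mulVec_mulVec, ih, leftMulMatrix_mulVec]
    simp only [pow_succ', Matrix.mul_assoc]

variable {A}

theorem commute_leftMulMatrix (hA : ∀ j, IsNode (A j)) (i i' : Fin d) :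
    Commute (leftMulMatrix A i) (leftMulMatrix A i') := by
  refine Matrix.ext_of_mulVec_single fun x => ?_
  obtain ⟨B, hB⟩ := entries_surjective (Pi.single x (1 : ℂ))
  rw [← hB, ← Matrix.mulVec_mulVec, ← Matrix.mulVec_mulVec]
  simp only [leftMulMatrix_mulVec, ← Matrix.mul_assoc, ((hA _).commute i i').eq]

theorem tendsto_leftMulMatrix_pow (hA : ∀ j, IsNode (A j)) (i : Fin d) :
    Filter.Tendsto (fun n => leftMulMatrix A i ^ n) Filter.atTop (nhds 0) := by
  refine tendsto_pi_nhds.mpr fun x => tendsto_pi_nhds.mpr fun y => ?_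
  obtain ⟨B, hB⟩ := entries_surjective (Pi.single y (1 : ℂ))
  have h1 : ∀ n, (leftMulMatrix A i ^ n) x y = (A x.1 i ^ n * B x.1) x.2.1 x.2.2 := fun n => by
    have := congrFun (leftMulMatrix_pow_mulVec A i B n) x
    rw [hB, Matrix.mulVec_single_one] at this
    exact this
  simp only [h1]
  have h2 : Filter.Tendsto (fun n => A x.1 i ^ n * B x.1) Filter.atTop (nhds 0) := by
    simpa using ((hA x.1).tendsto_pow i).mul_const (B x.1)
  exact tendsto_pi_nhds.mp (tendsto_pi_nhds.mp h2 x.2.1) x.2.2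

theorem AdmissibleKernel.inner_nodeKernel_single (k : AdmissibleKernel d)
    (hA : ∀ j, IsNode (A j)) (j : Fin N)
    (a b : Fin (s j)) (f : k.H) :
    inner ℂ (k.nodeKernel (hA j) (Pi.single b 1) (Pi.single a 1)) f =
      matEval (extendZero f) (A j) a b := by
  rw [k.inner_nodeKernel]
  simp

/-- An operator `R` on the node space transports a function `f` to a function `g` with
`g(A_j) = φ_j(A_j) f(A_j)`. -/
theorem AdmissibleKernel.IsR.exists_matEval_eq {k : AdmissibleKernel d} {hA : ∀ j, IsNode (A j)}
    {φ : Fin N → (Fin d → ℂ) → ℂ} {R : k.nodeSpace hA →L[ℂ] k.nodeSpace hA} (hR : k.IsR hA φ R)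
    (f : k.H) : ∃ g : k.H, ‖g‖ ≤ ‖R‖ * ‖f‖ ∧
      ∀ j, matEval (extendZero g) (A j) = matEval (φ j) (A j) * matEval (extendZero f) (A j) := by
  -- The functional `x ↦ ⟨f, R x⟩`, in Mathlib's order of arguments; the vector representing it
  -- serves as an adjoint image of `f`.
  let T : k.nodeSpace hA →L[ℂ] ℂ :=
    ((innerSL ℂ f).comp (k.nodeSpace hA).subtypeL).comp R
  obtain ⟨g, hg, hgT⟩ := exists_inner_eq_of_subspace (k.nodeSpace hA) T
  refine ⟨g, ?_, fun j => ?_⟩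
  · rw [hg]
    refine ContinuousLinearMap.opNorm_le_bound _ (by positivity) fun x => ?_
    calc ‖inner ℂ f (R x).1‖ ≤ ‖f‖ * ‖(R x).1‖ := norm_inner_le_norm _ _
      _ ≤ ‖f‖ * (‖R‖ * ‖x‖) := mul_le_mul_of_nonneg_left (R.le_opNorm x) (norm_nonneg _)
      _ = _ := by ring
  · ext a b
    have h1 := hgT ⟨_, k.nodeKernel_mem hA j (Pi.single b 1) (Pi.single a 1)⟩
    have h2 : T ⟨_, k.nodeKernel_mem hA j (Pi.single b 1) (Pi.single a 1)⟩ = inner ℂ f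
        (k.nodeKernel (hA j) (Pi.single b 1) ((matEval (φ j) (A j))ᴴ *ᵥ Pi.single a 1)) :=
      congrArg (fun x : k.nodeSpace hA => inner ℂ f x.1) (hR j _ _)
    rw [h2, ← inner_conj_symm, ← inner_conj_symm f, k.inner_nodeKernel_single,
      k.inner_nodeKernel] at h1
    rw [(starRingEnd ℂ).injective h1, Matrix.star_mulVec, Matrix.conjTranspose_conjTranspose,
      ← Matrix.dotProduct_mulVec, Matrix.mulVec_mulVec]
    simp

theorem AdmissibleKernel.exists_isR_of_normR_lt {k : AdmissibleKernel d}
    {hA : ∀ j, IsNode (A j)} {φ : Fin N → (Fin d → ℂ) → ℂ} {C : ℝ}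
    (h : k.normR hA φ < ENNReal.ofReal C) : ∃ R, k.IsR hA φ R ∧ ‖R‖ ≤ C := by
  rw [AdmissibleKernel.normR, iInf_lt_iff] at h
  obtain ⟨R, h⟩ := h
  rw [iInf_lt_iff] at h
  obtain ⟨hR, h⟩ := h
  refine ⟨R, hR, ?_⟩
  rw [← ofReal_norm] at h
  exact ((ENNReal.ofReal_lt_ofReal_iff_of_nonneg (norm_nonneg _)).mp h).le

theorem norm_toLp_mulVec_sq {ι : Type*} [Fintype ι] (W : Matrix ι ι ℂ) (p : ι → ℂ) :
    ‖(WithLp.toLp 2 (W *ᵥ p) : EuclideanSpace ℂ ι)‖ ^ 2 = (star p ⬝ᵥ ((Wᴴ * W) *ᵥ p)).re := by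
  rw [star_dotProduct_conjTranspose_mul_self_mulVec, Complex.ofReal_re, EuclideanSpace.norm_sq_eq]

open scoped ComplexOrder in
-- The form `H = W* W` gives a map `V f = W f(A)` on the Hardy space, and `hL` says that
-- multiplication by a coordinate does not increase `‖V f‖`. It can therefore be added to the norm.
-- In the kernel so obtained, duality sends 1 to some `g` with `g(A_j) = φ_j(A_j)` and controlled
-- norm.
theorem re_dotProduct_entries_le (hA : ∀ j, IsNode (A j)) (φ : Fin N → (Fin d → ℂ) → ℂ) {C : ℝ}
    (hC : 0 ≤ C) (h : ∀ k : AdmissibleKernel d, k.normR hA φ ≤ ENNReal.ofReal C)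
    {H : Matrix (Σ j, Fin (s j) × Fin (s j)) (Σ j, Fin (s j) × Fin (s j)) ℂ}
    (hH : H.PosSemidef)
    (hL : ∀ i, (H - (leftMulMatrix A i)ᴴ * H * leftMulMatrix A i).PosSemidef) :
    (star (entries fun j => matEval (φ j) (A j)) ⬝ᵥ
      (H *ᵥ entries fun j => matEval (φ j) (A j))).re ≤
      C ^ 2 * (star (entries (s := s) fun _ => 1) ⬝ᵥ (H *ᵥ entries fun _ => 1)).re := by
  obtain ⟨k₀, f₁, hf₁⟩ := exists_admissibleKernel_one d
  obtain ⟨W, rfl⟩ := hH.exists_eq_conjTranspose_mul_self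
  let V : k₀.H →L[ℂ] EuclideanSpace ℂ (Σ j, Fin (s j) × Fin (s j)) :=
    (WithLp.linearEquiv 2 ℂ ((Σ j, Fin (s j) × Fin (s j)) → ℂ)).symm.toLinearMap.toContinuousLinearMap.comp
    ((Matrix.toLin' W).toContinuousLinearMap.comp (ContinuousLinearMap.pi fun x =>
      innerSL ℂ (k₀.nodeKernel (hA x.1) (Pi.single x.2.2 1) (Pi.single x.2.1 1))))
  have hV : ∀ f, V f = WithLp.toLp 2 (W *ᵥ entries fun j => matEval (extendZero f) (A j)) := by
    intro f
    have : (fun x : Σ j, Fin (s j) × Fin (s j) => inner ℂ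
        (k₀.nodeKernel (hA x.1) (Pi.single x.2.2 1) (Pi.single x.2.1 1)) f) =
        entries fun j => matEval (extendZero f) (A j) :=
      funext fun x => k₀.inner_nodeKernel_single hA x.1 _ _ f
    rw [← this]
    rfl
  have hVn : ∀ f, ‖V f‖ ^ 2 = (star (entries fun j => matEval (extendZero f) (A j)) ⬝ᵥ
      ((Wᴴ * W) *ᵥ entries fun j => matEval (extendZero f) (A j))).re := fun f => by
    rw [hV, norm_toLp_mulVec_sq]
  have hVmul : ∀ (i : Fin d) (f g : k₀.H), (∀ z, g z = z.1 i * f z) → ‖V g‖ ≤ ‖V f‖ := by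
    intro i f g hg
    refine le_of_sq_le_sq ?_ (norm_nonneg _)
    have h1 : (entries fun j => matEval (extendZero g) (A j)) =
        leftMulMatrix A i *ᵥ entries fun j => matEval (extendZero f) (A j) := by
      rw [leftMulMatrix_mulVec]
      congr 1
      ext1 j
      rw [← (hA j).matEval_coord_mul (k₀.holomorphic f)]
      refine (hA j).matEval_congr (extendZero_eqOn fun z => ?_)
      rw [hg, extendZero_apply]
    rw [hVn, hVn, h1]
    have h2 := (Complex.le_def.mp ((hL i).dotProduct_mulVec_nonneg
      (entries fun j => matEval (extendZero f) (A j)))).1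
    rw [Matrix.sub_mulVec, dotProduct_sub, Complex.sub_re, Complex.zero_re] at h2
    rw [Matrix.star_mulVec, ← Matrix.dotProduct_mulVec, Matrix.mulVec_mulVec,
      Matrix.mulVec_mulVec]
    simp only [Matrix.mul_assoc] at h2 ⊢
    linarith
  set q₁ := (star (entries (s := s) fun _ => 1) ⬝ᵥ ((Wᴴ * W) *ᵥ entries fun _ => 1)).re with hq₁
  set q := (star (entries fun j => matEval (φ j) (A j)) ⬝ᵥ
      ((Wᴴ * W) *ᵥ entries fun j => matEval (φ j) (A j))).re with hq
  have hone : ∀ j, matEval (extendZero f₁) (A j) = 1 := fun j => by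
    rw [← (hA j).matEval_one]
    exact (hA j).matEval_congr (extendZero_eqOn hf₁)
  -- The norm used is `‖f‖² + t⁻¹ ‖V f‖²`, so that the Hardy part disappears after multiplying by
  -- `t` and letting `t → 0`. The slack `C' > C` is there because the norm of `R^k` is defined as an
  -- infimum.
  have key : ∀ t : ℝ, 0 < t → ∀ C' : ℝ, C < C' → q ≤ C' ^ 2 * (t * ‖f₁‖ ^ 2 + q₁) := by
    intro t ht C' hC'
    have hts : (Real.sqrt t)⁻¹ ^ 2 = t⁻¹ := by rw [inv_pow, Real.sq_sqrt ht.le]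
    have hn : ∀ f, ‖((((Real.sqrt t)⁻¹ : ℝ) : ℂ) • V) f‖ ^ 2 = t⁻¹ * ‖V f‖ ^ 2 := fun f => by
      rw [smul_apply, norm_smul, mul_pow, Complex.norm_real, Real.norm_eq_abs, sq_abs, hts]
    obtain ⟨k, hk1, hk2⟩ := exists_graph_kernel k₀ ((((Real.sqrt t)⁻¹ : ℝ) : ℂ) • V)
      fun i f g hg => by
        rw [smul_apply, smul_apply, norm_smul, norm_smul]
        exact mul_le_mul_of_nonneg_left (hVmul i f g hg) (norm_nonneg _)
    obtain ⟨R, hR, hRn⟩ := AdmissibleKernel.exists_isR_of_normR_lt ((h k).trans_lt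
      ((ENNReal.ofReal_lt_ofReal_iff_of_nonneg hC).mpr hC'))
    obtain ⟨f, hf, hff⟩ := hk2 f₁
    obtain ⟨g, hg, hgm⟩ := hR.exists_matEval_eq f
    obtain ⟨a, ha, hga⟩ := hk1 g
    have h1 : ∀ j, matEval (extendZero a) (A j) = matEval (φ j) (A j) := fun j => by
      have h2 : matEval (extendZero f) (A j) = 1 := by rw [← hone, show ⇑f = ⇑f₁ from funext hff]
      rw [← show ⇑g = ⇑a from funext hga, hgm, h2, mul_one]
    have h3 : ‖V a‖ ^ 2 = q := by rw [hVn]; simp only [h1, hq]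
    have h4 : ‖V f₁‖ ^ 2 = q₁ := by rw [hVn]; simp only [hone, hq₁]
    rw [hn, h3] at ha
    rw [hn, h4] at hf
    have h5 : ‖g‖ ^ 2 ≤ C' ^ 2 * ‖f‖ ^ 2 := by
      rw [← mul_pow]
      exact pow_le_pow_left₀ (norm_nonneg _)
        (hg.trans (mul_le_mul_of_nonneg_right hRn (norm_nonneg _))) 2
    have h6 : t⁻¹ * q ≤ C' ^ 2 * (‖f₁‖ ^ 2 + t⁻¹ * q₁) :=
      calc t⁻¹ * q ≤ ‖g‖ ^ 2 := by rw [← ha]; linarith [sq_nonneg ‖a‖]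
        _ ≤ _ := h5.trans (mul_le_mul_of_nonneg_left hf (sq_nonneg _))
    have h7 := mul_le_mul_of_nonneg_left h6 ht.le
    rw [← mul_assoc, mul_inv_cancel₀ ht.ne', one_mul] at h7
    refine h7.trans (le_of_eq ?_)
    field_simp
  have hlim : Filter.Tendsto (fun t : ℝ => (C + t) ^ 2 * (t * ‖f₁‖ ^ 2 + q₁))
      (nhdsWithin 0 (Set.Ioi 0)) (nhds (C ^ 2 * q₁)) := by
    have : Continuous fun t : ℝ => (C + t) ^ 2 * (t * ‖f₁‖ ^ 2 + q₁) := by fun_prop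
    simpa using (this.tendsto 0).mono_left nhdsWithin_le_nhds
  refine ge_of_tendsto hlim ?_
  filter_upwards [self_mem_nhdsWithin] with t ht
  exact key t ht _ (lt_add_of_pos_right C ht)

end evaluation

/-! ### From the inequality to a contractive realization on the matrices -/

section decomposition

open scoped ComplexOrder

variable {d N : ℕ} {s : Fin N → ℕ} {A : ∀ j, Fin d → Matrix (Fin (s j)) (Fin (s j)) ℂ}

theorem exists_lyapunov_leftMulMatrix (hA : ∀ j, IsNode (A j)) :
    ∃ G : Matrix (Σ j, Fin (s j) × Fin (s j)) (Σ j, Fin (s j) × Fin (s j)) ℂ,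
      (G - 1).PosSemidef ∧
      ∀ i, (G - (leftMulMatrix A i)ᴴ * G * leftMulMatrix A i - 1).PosSemidef := by
  obtain ⟨G, hG, hGi⟩ := exists_lyapunov (leftMulMatrix A) (commute_leftMulMatrix hA)
    (tendsto_leftMulMatrix_pow hA) Finset.univ
  exact ⟨G, hG, fun i => hGi i (Finset.mem_univ i)⟩

theorem exists_node_realization (hA : ∀ j, IsNode (A j)) (φ : Fin N → (Fin d → ℂ) → ℂ) {C : ℝ}
    (hC : 0 ≤ C) (h : ∀ k : AdmissibleKernel d, k.normR hA φ ≤ ENNReal.ofReal C) :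
    ∃ (κ : Type) (_ : Fintype κ) (_ : DecidableEq κ) (p : κ → Fin d)
      (U : Matrix (Option κ) (Option κ) ℂ) (g : κ → ∀ j, Matrix (Fin (s j)) (Fin (s j)) ℂ),
      (1 - Uᴴ * U).PosSemidef ∧
      (∀ j, matEval (φ j) (A j) = (C * U none none) • (1 : Matrix (Fin (s j)) (Fin (s j)) ℂ) +
        ∑ t, U none (some t) • (A j (p t) * g t j)) ∧
      ∀ r j, g r j = (C * U (some r) none) • (1 : Matrix (Fin (s j)) (Fin (s j)) ℂ) +
        ∑ t, U (some r) (some t) • (A j (p t) * g t j) := by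
  let e := entries (s := s) fun _ => 1
  let β := entries fun j => matEval (φ j) (A j)
  -- The extra index with `X = 0` makes its Lyapunov inequality read `H ≥ 0`; its `Γ` is then a free
  -- positive semidefinite slack term.
  let X : Option (Fin d) → Matrix (Σ j, Fin (s j) × Fin (s j)) (Σ j, Fin (s j) × Fin (s j)) ℂ :=
    fun o => o.elim 0 (leftMulMatrix A)
  let T := ((C ^ 2 : ℝ) : ℂ) • Matrix.vecMulVec e (star e) - Matrix.vecMulVec β (star β)
  have hT : T.IsHermitian := by
    refine Matrix.IsHermitian.sub ?_ (Matrix.posSemidef_vecMulVec_self_star β).isHermitian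
    rw [Matrix.IsHermitian, Matrix.conjTranspose_smul,
      (Matrix.posSemidef_vecMulVec_self_star e).isHermitian.eq]
    simp
  obtain ⟨G, hG, hGi⟩ := exists_lyapunov_leftMulMatrix hA
  obtain ⟨Γ, hΓ, hTΓ⟩ := exists_posSemidef_decomposition X T hT G
    (fun o => by cases o with
      | none => simpa [X] using hG
      | some i => exact hGi i)
    fun H hH => by
      have h1 := re_dotProduct_entries_le hA φ hC h (H := H) (by simpa [X] using hH none)
        fun i => hH (some i)
      simp only [T, Matrix.mul_sub, Matrix.mul_smul, Matrix.trace_sub, Matrix.trace_smul,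
        trace_mul_vecMulVec_star, Complex.sub_re, smul_eq_mul, Complex.re_ofReal_mul]
      linarith
  obtain ⟨U, g, hU, hβ, hg⟩ := exists_realization (leftMulMatrix A) (fun i => Γ (some i)) e β C
    (fun i => hΓ _) (by
      rw [Fintype.sum_option] at hTΓ
      rw [show _ - _ = _ from hTΓ]
      simpa [X] using hΓ none)
  choose g' hg' using fun t => entries_surjective (s := s) (g t)
  have hlin : ∀ (c : ℂ) (u : Fin d × (Σ j, Fin (s j) × Fin (s j)) → ℂ),
      c • e + ∑ t, u t • (leftMulMatrix A t.1 *ᵥ g t) = entries fun j =>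
        c • (1 : Matrix (Fin (s j)) (Fin (s j)) ℂ) + ∑ t, u t • (A j t.1 * g' t j) := by
    intro c u
    simp only [← hg', leftMulMatrix_mulVec]
    ext x
    simp [entries, e, Matrix.sum_apply]
  rw [hlin] at hβ
  simp only [hlin] at hg
  exact ⟨Fin d × (Σ j, Fin (s j) × Fin (s j)), inferInstance, inferInstance, fun t => t.1, U, g', hU,
    fun j => congrFun (entries_injective hβ) j,
    fun r j => congrFun (entries_injective ((hg' r).trans (hg r))) j⟩

end decomposition

/-! ### Transfer functions and their values on nodes -/

theorem IsNode.matEval_const_add_sum {d m : ℕ} {κ : Type*} [Fintype κ]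
    {M : Fin d → Matrix (Fin m) (Fin m) ℂ} (hM : IsNode M) (c : ℂ) (u : κ → ℂ)
    {f : κ → (Fin d → ℂ) → ℂ} (hf : ∀ t, DifferentiableOn ℂ (f t) (polydisc d))
    {F : (Fin d → ℂ) → ℂ} (hF : DifferentiableOn ℂ F (polydisc d)) (q : κ → Fin d) :
    matEval (fun z => c * F z + ∑ t, u t * (z (q t) * f t z)) M =
      c • matEval F M + ∑ t, u t • (M (q t) * matEval (f t) M) := by
  have h1 := fun t => differentiableOn_coord_mul (hf t) (q t)
  rw [hM.matEval_add (hF.const_mul c) (DifferentiableOn.fun_sum fun t _ => (h1 t).const_mul _),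
    matEval_const_mul, hM.matEval_sum _ fun t => (h1 t).const_mul _]
  simp only [matEval_const_mul, hM.matEval_coord_mul (hf _)]

section transfer

open scoped ComplexOrder

variable {d : ℕ} {κ : Type*} [Fintype κ] [DecidableEq κ] (U : Matrix (Option κ) (Option κ) ℂ)
  (p : κ → Fin d)

/-- The resolvent `(1 - D E(z))⁻¹` of a system with block matrix `U = [a b; c D]`. -/
def systemResolvent (z : Fin d → ℂ) : Matrix κ κ ℂ :=
  (1 - Matrix.of fun r t => U (some r) (some t) * z (p t))⁻¹

/-- The state vector `(1 - D E(z))⁻¹ c`. -/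
def systemState (r : κ) (z : Fin d → ℂ) : ℂ :=
  ∑ t, U (some t) none * systemResolvent U p z r t

/-- The transfer function `a + b E(z) (1 - D E(z))⁻¹ c`. -/
def transferFunction (z : Fin d → ℂ) : ℂ :=
  U none none + ∑ t, U none (some t) * (z (p t) * systemState U p t z)

variable {U} {p}

/-- A kernel vector satisfies `v = D E(z) v`, so contractivity of `U` on `(0, E(z) v)` gives `‖v‖ ≤
‖E(z) v‖`; but `E(z)` strictly decreases the norm of nonzero vectors. -/
theorem det_system_ne_zero (hU : (1 - Uᴴ * U).PosSemidef) {z : Fin d → ℂ} (hz : z ∈ polydisc d) :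
    (1 - Matrix.of fun r t => U (some r) (some t) * z (p t)).det ≠ 0 := by
  intro h
  obtain ⟨v, hv0, hv⟩ := Matrix.exists_mulVec_eq_zero_iff.mpr h
  rw [Matrix.sub_mulVec, Matrix.one_mulVec, sub_eq_zero] at hv
  have h1 := sum_norm_sq_le_of_contraction hU
    (fun o : Option κ => o.elim 0 fun t => z (p t) * v t)
  simp only [Fintype.sum_option, Option.elim_none, Option.elim_some, norm_zero,
    smul_eq_mul, mul_zero, zero_add] at h1
  have h2 : ∀ r, ∑ t, U (some r) (some t) * (z (p t) * v t) = v r := fun r => by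
    conv_rhs => rw [hv]
    simp [Matrix.mulVec, dotProduct, mul_assoc]
  simp only [h2] at h1
  have h3 : ∑ t, ‖v t‖ ^ 2 ≤ ∑ t, ‖z (p t) * v t‖ ^ 2 := by
    nlinarith [sq_nonneg ‖∑ t, U none (some t) * (z (p t) * v t)‖]
  obtain ⟨t₀, ht₀⟩ := Function.ne_iff.mp hv0
  refine absurd h3 (not_le.mpr (Finset.sum_lt_sum (fun t _ => ?_) ⟨t₀, Finset.mem_univ _, ?_⟩))
  · rw [norm_mul, mul_pow]
    exact mul_le_of_le_one_left (sq_nonneg _) (pow_le_one₀ (norm_nonneg _) (hz _).le)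
  · rw [norm_mul, mul_pow]
    have : 0 < ‖v t₀‖ := norm_pos_iff.mpr ht₀
    exact mul_lt_of_lt_one_left (by positivity) (pow_lt_one₀ (norm_nonneg _) (hz _) two_ne_zero)

theorem differentiableOn_systemResolvent (hU : (1 - Uᴴ * U).PosSemidef) (r t : κ) :
    DifferentiableOn ℂ (fun z => systemResolvent U p z r t) (polydisc d) := by
  refine DifferentiableOn.matrix_inv_apply (fun i j => ?_) (fun z hz => det_system_ne_zero hU hz)
    r t
  simp only [Matrix.sub_apply, Matrix.of_apply]
  fun_prop

theorem differentiableOn_systemState (hU : (1 - Uᴴ * U).PosSemidef) (r : κ) :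
    DifferentiableOn ℂ (systemState U p r) (polydisc d) :=
  DifferentiableOn.fun_sum fun t _ => (differentiableOn_systemResolvent hU r t).const_mul _

theorem differentiableOn_transferFunction (hU : (1 - Uᴴ * U).PosSemidef) :
    DifferentiableOn ℂ (transferFunction U p) (polydisc d) :=
  (DifferentiableOn.fun_sum fun t _ =>
    (differentiableOn_coord_mul (differentiableOn_systemState hU t) _).const_mul _).const_add _

theorem systemState_eq (hU : (1 - Uᴴ * U).PosSemidef) {z : Fin d → ℂ} (hz : z ∈ polydisc d)
    (r : κ) : systemState U p r z = U (some r) none +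
      ∑ t, U (some r) (some t) * (z (p t) * systemState U p t z) := by
  have h1 : (1 - Matrix.of fun r t => U (some r) (some t) * z (p t)) *
      systemResolvent U p z = 1 :=
    Matrix.mul_nonsing_inv _ (isUnit_iff_ne_zero.mpr (det_system_ne_zero hU hz))
  have h2 := congrFun (congrArg (fun Q => Q *ᵥ fun t => U (some t) none) h1) r
  have h3 : (systemResolvent U p z *ᵥ fun t => U (some t) none) = fun r => systemState U p r z := by
    ext r
    simp [Matrix.mulVec, dotProduct, systemState, mul_comm]
  simp only [← Matrix.mulVec_mulVec, h3, Matrix.sub_mulVec, Matrix.one_mulVec, Pi.sub_apply] at h2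
  rw [← h2]
  simp [Matrix.mulVec, dotProduct, mul_assoc]

theorem systemResolvent_eq (hU : (1 - Uᴴ * U).PosSemidef) {z : Fin d → ℂ} (hz : z ∈ polydisc d)
    (r u : κ) : systemResolvent U p z r u = (1 : Matrix κ κ ℂ) r u +
      ∑ t, U (some t) (some u) * (z (p u) * systemResolvent U p z r t) := by
  have h1 : systemResolvent U p z * (1 - Matrix.of fun r t => U (some r) (some t) * z (p t)) = 1 :=
    Matrix.nonsing_inv_mul _ (isUnit_iff_ne_zero.mpr (det_system_ne_zero hU hz))
  rw [← h1, Matrix.mul_sub, Matrix.mul_one, Matrix.sub_apply, Matrix.mul_apply]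
  simp only [Matrix.of_apply]
  rw [sub_add, ← Finset.sum_sub_distrib, Finset.sum_eq_zero, sub_zero]
  intro t _
  ring

/-- `U` maps `(1, E(z) x)` to `(F(z), x)`, where `x` is the state, so `|F|² + ‖x‖² ≤ 1 + ‖E(z) x‖² ≤
1 + ‖x‖²`. -/
theorem norm_transferFunction_le_one (hU : (1 - Uᴴ * U).PosSemidef) {z : Fin d → ℂ}
    (hz : z ∈ polydisc d) : ‖transferFunction U p z‖ ≤ 1 := by
  have h1 := sum_norm_sq_le_of_contraction hU
    (fun o : Option κ => o.elim 1 fun t => z (p t) * systemState U p t z)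
  simp only [Fintype.sum_option, Option.elim_none, Option.elim_some, smul_eq_mul, mul_one,
    norm_one, ← systemState_eq hU hz] at h1
  rw [← transferFunction] at h1
  have h2 : ∑ t, ‖z (p t) * systemState U p t z‖ ^ 2 ≤ ∑ t, ‖systemState U p t z‖ ^ 2 := by
    refine Finset.sum_le_sum fun t _ => ?_
    rw [norm_mul, mul_pow]
    exact mul_le_of_le_one_left (sq_nonneg _) (pow_le_one₀ (norm_nonneg _) (hz _).le)
  nlinarith [norm_nonneg (transferFunction U p z)]

variable {m : ℕ} {M : Fin d → Matrix (Fin m) (Fin m) ℂ}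

/-- Apply the calculus to `Q(z) = (1 - D E(z))⁻¹`, which satisfies `Q = 1 + Q D E`. Since `Y = D
E(M) Y`, this gives `Q(M) Y = Y + Q(M) Y`. Only multiplication by coordinates and commutation with
the `M i` are used. -/
theorem IsNode.eq_zero_of_system (hM : IsNode M) (hU : (1 - Uᴴ * U).PosSemidef)
    {Y : κ → Matrix (Fin m) (Fin m) ℂ}
    (hY : ∀ r, Y r = ∑ t, U (some r) (some t) • (M (p t) * Y t)) (r : κ) : Y r = 0 := by
  let Q : κ → κ → Matrix (Fin m) (Fin m) ℂ := fun r t => matEval (fun z => systemResolvent U p z r t) M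
  have hQ : ∀ r u, Q r u = (1 : Matrix κ κ ℂ) r u • (1 : Matrix (Fin m) (Fin m) ℂ) +
      ∑ t, U (some t) (some u) • (M (p u) * Q r t) := by
    intro r u
    rw [← hM.matEval_one, ← hM.matEval_const_add_sum _ _
      (fun t => differentiableOn_systemResolvent hU r t) (differentiableOn_const 1) fun _ => p u]
    refine hM.matEval_congr fun z hz => ?_
    simp only [mul_one]
    exact systemResolvent_eq hU hz r u
  have h1 : ∑ u, Q r u * Y u = Y r + ∑ t, Q r t * Y t := by
    calc ∑ u, Q r u * Y u
        = ∑ u, ((1 : Matrix κ κ ℂ) r u • Y u +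
            ∑ t, U (some t) (some u) • (Q r t * (M (p u) * Y u))) := by
          refine Finset.sum_congr rfl fun u _ => ?_
          conv_lhs => rw [hQ]
          rw [Matrix.add_mul, Matrix.smul_mul, Matrix.one_mul, Finset.sum_mul]
          congr 1
          refine Finset.sum_congr rfl fun t _ => ?_
          have : Commute (M (p u)) (Q r t) :=
            hM.commute_matEval (differentiableOn_systemResolvent hU r t) _
          rw [Matrix.smul_mul, this.eq, Matrix.mul_assoc]
      _ = Y r + ∑ t, Q r t * Y t := by
          rw [Finset.sum_add_distrib, Finset.sum_comm]
          congr 1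
          · simp [Matrix.one_apply]
          · refine Finset.sum_congr rfl fun t _ => ?_
            conv_rhs => rw [hY t, Finset.mul_sum]
            simp only [Matrix.mul_smul]
  simpa using h1

theorem IsNode.eq_of_system (hM : IsNode M) (hU : (1 - Uᴴ * U).PosSemidef)
    {B : κ → Matrix (Fin m) (Fin m) ℂ} {Y Y' : κ → Matrix (Fin m) (Fin m) ℂ}
    (hY : ∀ r, Y r = B r + ∑ t, U (some r) (some t) • (M (p t) * Y t))
    (hY' : ∀ r, Y' r = B r + ∑ t, U (some r) (some t) • (M (p t) * Y' t)) (r : κ) :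
    Y r = Y' r := by
  refine sub_eq_zero.mp (hM.eq_zero_of_system hU (p := p) (Y := fun r => Y r - Y' r) (fun r => ?_) r)
  simp only [Matrix.mul_sub, smul_sub, Finset.sum_sub_distrib]
  rw [hY r, hY' r]
  simp only [add_sub_add_left_eq_sub]

theorem IsNode.matEval_systemState (hM : IsNode M) (hU : (1 - Uᴴ * U).PosSemidef) (r : κ) :
    matEval (systemState U p r) M = U (some r) none • 1 +
      ∑ t, U (some r) (some t) • (M (p t) * matEval (systemState U p t) M) := by
  rw [← hM.matEval_one, ← hM.matEval_const_add_sum _ _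
    (fun t => differentiableOn_systemState hU t) (differentiableOn_const 1) p]
  refine hM.matEval_congr fun z hz => ?_
  simp only [mul_one]
  exact systemState_eq hU hz r

theorem IsNode.matEval_transferFunction (hM : IsNode M) (hU : (1 - Uᴴ * U).PosSemidef) :
    matEval (transferFunction U p) M = U none none • 1 +
      ∑ t, U none (some t) • (M (p t) * matEval (systemState U p t) M) := by
  rw [← hM.matEval_one, ← hM.matEval_const_add_sum _ _
    (fun t => differentiableOn_systemState hU t) (differentiableOn_const 1) p]
  refine hM.matEval_congr fun z hz => ?_
  simp only [mul_one]
  rfl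

/-- For the states `x_r`, the matrices `(x_r f)(M)` and `x_r(M) f(M)` solve the same linear system,
whose solution is unique. The output equation carries the identity over to the transfer function. -/
theorem IsNode.matEval_transferFunction_mul (hM : IsNode M) (hU : (1 - Uᴴ * U).PosSemidef)
    {f : (Fin d → ℂ) → ℂ} (hf : DifferentiableOn ℂ f (polydisc d)) :
    matEval (fun z => transferFunction U p z * f z) M =
      matEval (transferFunction U p) M * matEval f M := by
  have hGf : ∀ t, DifferentiableOn ℂ (fun z => systemState U p t z * f z) (polydisc d) :=
    fun t => (differentiableOn_systemState hU t).fun_mul hf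
  have h1 : ∀ r, matEval (fun z => systemState U p r z * f z) M =
      matEval (systemState U p r) M * matEval f M := by
    refine hM.eq_of_system hU (p := p) (B := fun r => U (some r) none • matEval f M)
      (fun r => ?_) fun r => ?_
    · rw [← hM.matEval_const_add_sum _ _ hGf hf p]
      refine hM.matEval_congr fun z hz => ?_
      conv_lhs => rw [systemState_eq hU hz]
      rw [add_mul, Finset.sum_mul]
      congr 1
      exact Finset.sum_congr rfl fun t _ => by ring
    · conv_lhs => rw [hM.matEval_systemState hU]
      simp only [Matrix.add_mul, Matrix.smul_mul, Matrix.one_mul, Finset.sum_mul, Matrix.mul_assoc]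
  rw [hM.matEval_transferFunction hU, Matrix.add_mul, Matrix.smul_mul, Matrix.one_mul,
    Finset.sum_mul]
  simp only [Matrix.smul_mul, Matrix.mul_assoc, ← h1]
  rw [← hM.matEval_const_add_sum _ _ hGf hf p]
  refine hM.matEval_congr fun z hz => ?_
  simp only [transferFunction, add_mul, Finset.sum_mul]
  congr 1
  exact Finset.sum_congr rfl fun t _ => by ring

end transfer

/-! ### Transfer functions as contractive multipliers of every admissible space -/

theorem AdmissibleKernel.inner_pointKernel {d : ℕ} (k : AdmissibleKernel d) (z : polydisc d)
    (f : k.H) : inner ℂ (k.pointKernel z) f = f z := by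
  rw [pointKernel, RKHS.kerFun_inner]
  simp

section multiplier

open scoped ComplexOrder

variable {d : ℕ} (k : AdmissibleKernel d)

/-- The linear combinations of the vectors `w(z) k_z`. -/
def AdmissibleKernel.weightedKernel (w : polydisc d → ℂ) : (polydisc d →₀ ℂ) →ₗ[ℂ] k.H :=
  Finsupp.linearCombination ℂ fun z => w z • k.pointKernel z

theorem AdmissibleKernel.inner_weightedKernel (w : polydisc d → ℂ) (c : polydisc d →₀ ℂ)
    (f : k.H) : inner ℂ (k.weightedKernel w c) f = c.sum fun z a => conj a * (conj (w z) * f z) := by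
  rw [weightedKernel, Finsupp.linearCombination_apply, Finsupp.sum, Finsupp.sum, sum_inner]
  simp only [inner_smul_left, k.inner_pointKernel]

/-- The left vector `x` is the adjoint of multiplication by `z^i` applied to the right one, `y`:
`‖x‖² = ⟨y, z^i x⟩ ≤ ‖y‖ ‖x‖`. -/
theorem AdmissibleKernel.norm_weightedKernel_coord_le (i : Fin d) (w : polydisc d → ℂ)
    (c : polydisc d →₀ ℂ) :
    ‖k.weightedKernel (fun z => conj (z.1 i) * w z) c‖ ≤ ‖k.weightedKernel w c‖ := by
  set x := k.weightedKernel (fun z => conj (z.1 i) * w z) c with hx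
  obtain ⟨g, hg, hgn⟩ := k.contraction i x
  have h1 : inner ℂ x x = inner ℂ (k.weightedKernel w c) g := by
    conv_lhs => rw [hx]
    rw [k.inner_weightedKernel, k.inner_weightedKernel]
    refine Finsupp.sum_congr fun z _ => ?_
    rw [hg, map_mul, Complex.conj_conj]
    ring
  have h2 : ‖x‖ * ‖x‖ ≤ ‖k.weightedKernel w c‖ * ‖x‖ := by
    rw [← inner_self_eq_norm_mul_norm (𝕜 := ℂ) x, h1]
    exact (RCLike.re_le_norm _).trans ((norm_inner_le_norm _ _).trans
      (mul_le_mul_of_nonneg_left hgn (norm_nonneg _)))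
  rcases (norm_nonneg x).eq_or_lt with h | h
  · rw [← h]; exact norm_nonneg _
  · exact le_of_mul_le_mul_right h2 h

theorem AdmissibleKernel.weightedKernel_add_sum {κ : Type*} [Fintype κ] (a : ℂ) (u : κ → ℂ)
    (w₀ : polydisc d → ℂ) (w : κ → polydisc d → ℂ) (c : polydisc d →₀ ℂ) :
    k.weightedKernel (fun z => a * w₀ z + ∑ t, u t * w t z) c =
      a • k.weightedKernel w₀ c + ∑ t, u t • k.weightedKernel (w t) c := by
  refine ext_inner_right ℂ fun f => ?_
  rw [inner_add_left, sum_inner]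
  simp only [inner_smul_left, k.inner_weightedKernel, Finsupp.sum]
  simp only [Finset.mul_sum]
  rw [Finset.sum_comm, ← Finset.sum_add_distrib]
  refine Finset.sum_congr rfl fun z _ => ?_
  simp only [map_add, map_mul, map_sum, add_mul, mul_add, Finset.sum_mul, Finset.mul_sum]
  congr 1
  · ring
  · exact Finset.sum_congr rfl fun t _ => by ring

variable {κ : Type*} [Fintype κ] [DecidableEq κ] {U : Matrix (Option κ) (Option κ) ℂ}
  {p : κ → Fin d}

/-- The argument for the pointwise bound by 1, repeated with vectors of `H_k`: the conjugate of `U`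
acts on combinations of kernel vectors weighted by the conjugate system, and the state terms cancel
because coordinates are contractive. -/
theorem AdmissibleKernel.norm_weightedKernel_transferFunction_le (hU : (1 - Uᴴ * U).PosSemidef)
    (c : polydisc d →₀ ℂ) :
    ‖k.weightedKernel (fun z => conj (transferFunction U p z.1)) c‖ ≤
      ‖k.weightedKernel (fun _ => 1) c‖ := by
  have h1 := sum_norm_sq_le_of_contraction (posSemidef_one_sub_conj hU)
    (fun o : Option κ => o.elim (k.weightedKernel (fun _ => 1) c) fun t =>
      k.weightedKernel (fun z => conj (z.1 (p t)) * conj (systemState U p t z.1)) c)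
  simp only [Fintype.sum_option, Option.elim_none, Option.elim_some,
    ← k.weightedKernel_add_sum, Matrix.map_apply, mul_one] at h1
  have h2 : (fun z : polydisc d => conj (transferFunction U p z.1)) = fun z =>
      conj (U none none) + ∑ t, conj (U none (some t)) *
        (conj (z.1 (p t)) * conj (systemState U p t z.1)) := by
    ext z
    simp [transferFunction]
  have h3 : ∀ r, (fun z : polydisc d => conj (systemState U p r z.1)) = fun z =>
      conj (U (some r) none) + ∑ t, conj (U (some r) (some t)) *
        (conj (z.1 (p t)) * conj (systemState U p t z.1)) := by
    intro r
    ext z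
    conv_lhs => rw [systemState_eq hU z.2]
    simp
  simp only [← h2, ← h3] at h1
  have h4 : ∑ t, ‖k.weightedKernel
      (fun z => conj (z.1 (p t)) * conj (systemState U p t z.1)) c‖ ^ 2 ≤
      ∑ t, ‖k.weightedKernel (fun z => conj (systemState U p t z.1)) c‖ ^ 2 :=
    Finset.sum_le_sum fun t _ =>
      pow_le_pow_left₀ (norm_nonneg _) (k.norm_weightedKernel_coord_le _ _ c) 2
  exact le_of_sq_le_sq (by linarith) (norm_nonneg _)

/-- By `h`, the would-be adjoint `k_z ↦ conj (ψ z) k_z` is well defined and contractive on the span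
of the kernel vectors. Composing it with `⟨f, ·⟩` and representing the result yields `ψ f`. -/
theorem AdmissibleKernel.exists_mul_of_norm_weightedKernel_le {ψ : polydisc d → ℂ}
    (h : ∀ c, ‖k.weightedKernel (fun z => conj (ψ z)) c‖ ≤ ‖k.weightedKernel (fun _ => 1) c‖)
    (f : k.H) : ∃ g : k.H, ‖g‖ ≤ ‖f‖ ∧ ∀ z, g z = ψ z * f z := by
  let K := k.weightedKernel fun _ => 1
  obtain ⟨S, hS⟩ := K.rangeRestrict.exists_rightInverse_of_surjective K.range_rangeRestrict
  have hKS : ∀ x : LinearMap.range K, K (S x) = x.1 := fun x =>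
    congrArg Subtype.val (LinearMap.congr_fun hS x)
  let T₀ : LinearMap.range K →ₗ[ℂ] ℂ :=
    (innerSL ℂ f).toLinearMap ∘ₗ k.weightedKernel (fun z => conj (ψ z)) ∘ₗ S
  have hT₀ : ∀ x, ‖T₀ x‖ ≤ ‖f‖ * ‖x‖ := fun x => by
    refine (norm_inner_le_norm _ _).trans (mul_le_mul_of_nonneg_left ?_ (norm_nonneg _))
    exact (h (S x)).trans (le_of_eq (congrArg norm (hKS x)))
  have hT₀K : ∀ c, T₀ ⟨K c, c, rfl⟩ = inner ℂ f (k.weightedKernel (fun z => conj (ψ z)) c) := by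
    intro c
    have h1 : K (S ⟨K c, c, rfl⟩ - c) = 0 := by rw [map_sub, hKS, sub_self]
    have h2 := h (S ⟨K c, c, rfl⟩ - c)
    rw [show k.weightedKernel (fun _ => 1) (S ⟨K c, c, rfl⟩ - c) = 0 from h1, norm_zero,
      norm_le_zero_iff, map_sub, sub_eq_zero] at h2
    exact congrArg (inner ℂ f) h2
  obtain ⟨g, hg, hgT⟩ := exists_inner_eq_of_subspace _ (T₀.mkContinuous ‖f‖ hT₀)
  refine ⟨g, hg.le.trans (T₀.mkContinuous_norm_le (norm_nonneg _) _), fun z => ?_⟩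
  have h1 := hgT ⟨K (Finsupp.single z 1), _, rfl⟩
  rw [LinearMap.mkContinuous_apply, hT₀K] at h1
  have h2 := congrArg conj h1
  rw [inner_conj_symm, inner_conj_symm] at h2
  simpa [K, weightedKernel, inner_smul_left, k.inner_pointKernel] using h2

theorem AdmissibleKernel.exists_mul_transferFunction (hU : (1 - Uᴴ * U).PosSemidef) :
    ∃ T : k.H →L[ℂ] k.H, ‖T‖ ≤ 1 ∧ ∀ f z, T f z = transferFunction U p z.1 * f z := by
  choose T₀ hn hT₀ using k.exists_mul_of_norm_weightedKernel_le
    (k.norm_weightedKernel_transferFunction_le (p := p) hU)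
  let T : k.H →ₗ[ℂ] k.H :=
    { toFun := T₀
      map_add' := fun f g => RKHS.ext fun z => by
        simp only [hT₀, RKHS.coe_add, Pi.add_apply, mul_add]
      map_smul' := fun c f => RKHS.ext fun z => by
        simp only [hT₀, RKHS.coe_smul, Pi.smul_apply, smul_eq_mul, RingHom.id_apply]
        ring }
  exact ⟨T.mkContinuous 1 fun f => (hn f).trans (one_mul _).ge,
    T.mkContinuous_norm_le zero_le_one _, hT₀⟩

end multiplier

/-! ### Norms of `R^k` and its extensions; interpolation -/

section operators

open scoped ComplexOrder

variable {d N : ℕ} {s : Fin N → ℕ} {A : ∀ j, Fin d → Matrix (Fin (s j)) (Fin (s j)) ℂ}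
  {hA : ∀ j, IsNode (A j)} {φ : Fin N → (Fin d → ℂ) → ℂ}

theorem AdmissibleKernel.normR_le_normRExt (k : AdmissibleKernel d) (z : polydisc d) (w : ℂ) :
    k.normR hA φ ≤ k.normRExt hA φ z w := by
  refine le_iInf₂ fun R hR => ?_
  let ι : k.nodeSpace hA →ₗᵢ[ℂ] k.nodeSpaceExt hA z :=
    ⟨Submodule.inclusion le_sup_left, fun _ => rfl⟩
  let T : k.nodeSpace hA →L[ℂ] k.H :=
    (k.nodeSpaceExt hA z).subtypeL.comp (R.comp ι.toContinuousLinearMap)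
  -- An extension maps into `H₁` a priori; its values on the generators show that it preserves `H₀`.
  have hT : ∀ x, T x ∈ k.nodeSpace hA := by
    have h : k.nodeSpace hA ≤ ((k.nodeSpace hA).comap T.toLinearMap).map
        (k.nodeSpace hA).subtype := by
      refine Submodule.span_le.mpr ?_
      rintro _ ⟨j, u, v, rfl⟩
      refine ⟨⟨_, k.nodeKernel_mem hA j u v⟩, ?_, rfl⟩
      have h1 : T ⟨_, k.nodeKernel_mem hA j u v⟩ =
          k.nodeKernel (hA j) u ((matEval (φ j) (A j))ᴴ *ᵥ v) := congrArg Subtype.val (hR.1 j u v)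
      change T ⟨_, k.nodeKernel_mem hA j u v⟩ ∈ k.nodeSpace hA
      rw [h1]
      exact k.nodeKernel_mem hA j _ _
    intro x
    obtain ⟨y, hy, hyx⟩ := h x.2
    rw [← Subtype.ext hyx]
    exact hy
  have hR' : k.IsR hA φ (T.codRestrict _ hT) := fun j u v =>
    Subtype.ext (congrArg Subtype.val (hR.1 j u v) :)
  refine (iInf₂_le _ hR').trans ?_
  rw [← ofReal_norm, ← ofReal_norm]
  refine ENNReal.ofReal_le_ofReal (ContinuousLinearMap.opNorm_le_bound _ (norm_nonneg _) fun x => ?_)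
  exact R.le_opNorm (ι x)

/-- The adjoint of `T` acts on the vectors `K_{A_j}(u, v)` and `k_z` exactly as the extension must,
so its restriction to `H₁` is that extension. -/
theorem AdmissibleKernel.normRExt_le_of_adjoint (k : AdmissibleKernel d) {z : polydisc d} {w : ℂ}
    {C : ℝ} (T : k.H →L[ℂ] k.H) (hT : ‖T‖ ≤ C) (hTz : ∀ f, T f z = w * f z)
    (hTA : ∀ f j, matEval (extendZero (T f)) (A j) =
      matEval (φ j) (A j) * matEval (extendZero f) (A j)) :
    k.normRExt hA φ z w ≤ ENNReal.ofReal C := by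
  let L := ContinuousLinearMap.adjoint T
  have h1 : ∀ j u v, L (k.nodeKernel (hA j) u v) =
      k.nodeKernel (hA j) u ((matEval (φ j) (A j))ᴴ *ᵥ v) := fun j u v => by
    refine ext_inner_right ℂ fun f => ?_
    rw [ContinuousLinearMap.adjoint_inner_left, k.inner_nodeKernel, k.inner_nodeKernel, hTA,
      Matrix.star_mulVec, Matrix.conjTranspose_conjTranspose, ← Matrix.dotProduct_mulVec,
      Matrix.mulVec_mulVec]
  have h2 : L (k.pointKernel z) = conj w • k.pointKernel z := by
    refine ext_inner_right ℂ fun f => ?_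
    rw [ContinuousLinearMap.adjoint_inner_left, inner_smul_left, k.inner_pointKernel,
      k.inner_pointKernel, hTz, Complex.conj_conj]
  have h3 : k.nodeSpaceExt hA z ≤ (k.nodeSpaceExt hA z).comap L.toLinearMap := by
    refine sup_le (Submodule.span_le.mpr ?_) (Submodule.span_le.mpr ?_)
    · rintro _ ⟨j, u, v, rfl⟩
      change L _ ∈ k.nodeSpaceExt hA z
      rw [h1]
      exact k.nodeKernel_mem_ext hA z j _ _
    · rintro _ rfl
      change L _ ∈ k.nodeSpaceExt hA z
      rw [h2]
      exact Submodule.smul_mem _ _ (k.pointKernel_mem_ext hA z)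
  have h4 : ∀ x, L.comp (k.nodeSpaceExt hA z).subtypeL x ∈ k.nodeSpaceExt hA z :=
    fun x => h3 (show x.1 ∈ k.nodeSpaceExt hA z from x.2)
  have h5 : k.IsRExt hA φ z w ((L.comp (k.nodeSpaceExt hA z).subtypeL).codRestrict _ h4) :=
    ⟨fun j u v => Subtype.ext (h1 j u v), Subtype.ext h2⟩
  refine (iInf₂_le _ h5).trans ?_
  rw [← ofReal_norm]
  refine ENNReal.ofReal_le_ofReal (ContinuousLinearMap.opNorm_le_bound _
    ((norm_nonneg _).trans hT) fun x => ?_)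
  refine (L.le_opNorm x.1).trans (mul_le_mul_of_nonneg_right ?_ (norm_nonneg _))
  rwa [ContinuousLinearMap.adjoint.norm_map]

theorem exists_interpolating_transferFunction (hA : ∀ j, IsNode (A j)) {C : ℝ} (hC : 0 ≤ C)
    (h : ∀ k : AdmissibleKernel d, k.normR hA φ ≤ ENNReal.ofReal C) :
    ∃ (κ : Type) (_ : Fintype κ) (_ : DecidableEq κ) (p : κ → Fin d)
      (U : Matrix (Option κ) (Option κ) ℂ), (1 - Uᴴ * U).PosSemidef ∧
      ∀ j, matEval (φ j) (A j) = (C : ℂ) • matEval (transferFunction U p) (A j) := by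
  obtain ⟨κ, hκ, hκ', p, U, g, hU, hφ, hg⟩ := exists_node_realization hA φ hC h
  refine ⟨κ, hκ, hκ', p, U, hU, fun j => ?_⟩
  -- The matrices `g r j` from the lurking contraction and the scaled states at `A j` solve the same
  -- system, so they agree; the output equations then agree too.
  have h1 : ∀ r, g r j = (C : ℂ) • matEval (systemState U p r) (A j) := by
    refine (hA j).eq_of_system hU (p := p) (fun r => hg r j) fun r => ?_
    conv_lhs => rw [(hA j).matEval_systemState hU]
    simp only [smul_add, Finset.smul_sum, Matrix.mul_smul, smul_smul, mul_comm (C : ℂ)]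
  rw [hφ, (hA j).matEval_transferFunction hU]
  simp only [h1, smul_add, Finset.smul_sum, Matrix.mul_smul, smul_smul, mul_comm (C : ℂ)]

theorem exists_normRExt_le (hA : ∀ j, IsNode (A j)) {C : ℝ} (hC : 0 ≤ C)
    (h : ∀ k : AdmissibleKernel d, k.normR hA φ ≤ ENNReal.ofReal C) (z : polydisc d) :
    ∃ w : ℂ, ∀ k : AdmissibleKernel d, k.normRExt hA φ z w ≤ ENNReal.ofReal C := by
  obtain ⟨κ, _, _, p, U, hU, hφ⟩ := exists_interpolating_transferFunction hA hC h
  -- The value at `z` of one interpolating function, chosen before `k`.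
  refine ⟨C * transferFunction U p z.1, fun k => ?_⟩
  obtain ⟨T, hT, hTf⟩ := k.exists_mul_transferFunction (p := p) hU
  have hCT : ∀ f y, ((C : ℂ) • T) f y = C * (transferFunction U p y.1 * f y) := fun f y => by
    rw [smul_apply, RKHS.coe_smul, Pi.smul_apply, hTf, smul_eq_mul]
  refine k.normRExt_le_of_adjoint ((C : ℂ) • T) ?_ (fun f => ?_) fun f j => ?_
  · rw [norm_smul, Complex.norm_real, Real.norm_of_nonneg hC]
    exact mul_le_of_le_one_right hC hT
  · rw [hCT, mul_assoc]
  · rw [hφ, Matrix.smul_mul, ← (hA j).matEval_transferFunction_mul hU (k.holomorphic f),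
      ← matEval_const_mul]
    refine (hA j).matEval_congr (extendZero_eqOn fun y => ?_)
    rw [hCT, extendZero_apply]

end operators

open scoped ComplexOrder in
theorem supNorm_transferFunction_le_one {d : ℕ} {κ : Type*} [Fintype κ] [DecidableEq κ]
    {U : Matrix (Option κ) (Option κ) ℂ} {p : κ → Fin d} (hU : (1 - Uᴴ * U).PosSemidef) :
    supNorm (transferFunction U p) ≤ 1 := by
  refine iSup₂_le fun z hz => ?_
  rw [← ofReal_norm, ← ENNReal.ofReal_one]
  exact ENNReal.ofReal_le_ofReal (norm_transferFunction_le_one hU hz)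

end

theorem theorem2p1 :
    (∀ (N : ℕ) (s : Fin N → ℕ) (A : ∀ j, Fin 2 → Matrix (Fin (s j)) (Fin (s j)) ℂ)
        (hA : ∀ j, IsNode (A j)) (φ : Fin N → (Fin 2 → ℂ) → ℂ),
        (∀ j, MemHInfty (φ j)) →
        (⨆ k : AdmissibleKernel 2, k.normR hA φ) ≤ 1 →
        ∃ ψ : (Fin 2 → ℂ) → ℂ, MemHInfty ψ ∧ supNorm ψ ≤ 1 ∧
          ∀ j, matEval ψ (A j) = matEval (φ j) (A j)) ∧
    (∀ (d : ℕ), 1 ≤ d →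
      ∀ (N : ℕ) (s : Fin N → ℕ) (A : ∀ j, Fin d → Matrix (Fin (s j)) (Fin (s j)) ℂ)
        (hA : ∀ j, IsNode (A j)) (φ : Fin N → (Fin d → ℂ) → ℂ),
        (∀ j, MemHInfty (φ j)) →
        ∀ z : polydisc d, ∃ w : ℂ,
          (⨆ k : AdmissibleKernel d, k.normRExt hA φ z w) =
            ⨆ k : AdmissibleKernel d, k.normR hA φ) := by
  refine ⟨fun N s A hA φ _ h => ?_, fun d _ N s A hA φ _ z => ?_⟩
  · obtain ⟨κ, _, _, p, U, hU, hφ⟩ := exists_interpolating_transferFunction hA zero_le_one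
      fun k => ((le_iSup (fun k : AdmissibleKernel 2 => k.normR hA φ) k).trans h).trans
        ENNReal.ofReal_one.ge
    have h1 := supNorm_transferFunction_le_one (p := p) hU
    refine ⟨transferFunction U p, ⟨differentiableOn_transferFunction hU,
      h1.trans_lt ENNReal.one_lt_top⟩, h1, fun j => ?_⟩
    rw [hφ, Complex.ofReal_one, one_smul]
  · by_cases htop : (⨆ k : AdmissibleKernel d, k.normR hA φ) = ∞
    -- With an infinite supremum any `w` works, since extending never lowers the norm.
    · refine ⟨0, ?_⟩
      rw [htop, ← top_le_iff, ← htop]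
      exact iSup_mono fun k => k.normR_le_normRExt z 0
    · obtain ⟨w, hw⟩ := exists_normRExt_le hA ENNReal.toReal_nonneg (fun k => by
        rw [ENNReal.ofReal_toReal htop]
        exact le_iSup (fun k : AdmissibleKernel d => k.normR hA φ) k) z
      rw [ENNReal.ofReal_toReal htop] at hw
      exact ⟨w, le_antisymm (iSup_le hw) (iSup_mono fun k => k.normR_le_normRExt z w)⟩
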